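/- **Proposition 6.2 (Theorem 1.7 implies Theorem 1.6).** *Setting.* Let $k$ be an algebraically closed field, complete for a non-trivial non-Archimedean absolute value, and let $\phi:\mathbb P^1_k\to\mathbb P^1_k$ be a finite morphism, given by two forms of the same positive degree without common zero. Below, $L/k$ always denotes an algebraically closed complete non-Archimedean extension whose absolute value extends that of $k$, and $\phi_L^{\mathrm{an}}$ is the analytification of $\phi\times\mathrm{id}_L$. If $x\in\mathbb P^{1,\mathrm{an}}_k(L)$, i.e. $x$ is the image of an $L$-point of $\mathbb P^1$, this $L$-point is also written $x_L=[x_1:x_2]\in\mathbb P^1(L)\subset\mathbb P^{1,\mathrm{an}}_L$. Put $T=T_1/T_2$. *Balls.* For $x_L=a\ne\infty$ let $B(x_L,r)=\{|T-a|<r\}$, and $B(\infty,r)=\{|1/T|<r\}$. A *Berkovich open ball* of $\mathbb P^{1,\mathrm{an}}_L$ is a set $\{|T-a|<r\}$ or $\{|T-a|>r\}\ni\infty$ with $a\in L$, $r>0$. Let $A_t=\{|T_j|\le|T_t|\text{ for all }j\}$, $t=1,2$. The family $\mathcal O_{x_L}$ consists of the sets $W=\{p\in A_t: |(T_j/T_t-x_j/x_t)(p)|<r_j\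 (j\neq t)\}$ with $x_L\in A_t$ and $0<r_j\le1$; its tuple $h_L(W)=(r_{t,j})_{t,j}\in\mathbb R_{>0}^4$ has $r_{t,t}=1$ and $r_{t,j}$ the radius of $W$ in $A_t$ if $x_L\in A_t$, and $r_{t,j}=1$ for all $j$ if $x_L\notin A_t$. Let $S$ be the set of continuous functions $g:\mathbb R_{>0}^4\to\mathbb R_{>0}$ which are monotone for the coordinatewise order and definable (without parameters) in the language of ordered abelian groups in the multiplicative ordered group $\mathbb R_{>0}$. *Splitting.* A set $W\subset\mathbb P^{1,\mathrm{an}}_L$ *splits* (resp. *splits into balls*) if $(\phi_L^{\mathrm{an}})^{-1}(W)$ is a disjoint union of open sets (resp. of Berkovich open balls), each mapped homeomorphically onto $W$ by $\phi_L^{\mathrm{an}}$. *Retractions.* A deformation retraction of $\mathbb P^{1,\mathrm{an}}_k$ is a continuous map $\psi:I\times\mathbb P^{1,\mathrm{an}}_k\to\mathbb P^{1,\mathrm{an}}_k$, $I=[i,e]$, with $\psi(i,x)=x$, which fixes the points of its image $\Upsilon=\psi(e,\mathbb P^{1,\mathrm{an}}_k)$ at all times and satisfies $\psi(e,\psi(t,x))=\psi(e,x)$.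 The image is a finite simplicial complex if it is a finite union of arcs (possibly points) of $\mathbb P^{1,\mathrm{an}}_k$ between comparable points for the order with greatest element $\infty$ given on the affine line by $x\le y\iff |f(x)|\le|f(y)|$ for all $f\in k[T]$. For $M:\Upsilon\to\mathbb R_{\ge0}$, $\log M$ is *piecewise linear* if on each such arc contained in $\Upsilon$ there are finitely many values such that on every interval in $(0,\infty)$ avoiding them $\log M$ is an affine function of $\log\rho$, or is constantly $-\infty$; here $\rho(x)=\inf_{a\in k}|(T-a)(x)|$, $x\neq\infty$. ($M$ need not be continuous.) *(1.7) for $\phi$ (with $V=V'=\mathbb P^1$):* for every $g\in S$ there are a deformation retraction $\psi$ whose image $\Upsilon$ is a finite simplicial complex and a not identically zero function $M_g:\Upsilon\to\mathbb R_{\ge0}$ with $\log M_g$ piecewise linear, such that for all $\gamma\in\Upsilon$ with $M_g(\gamma)\ne0$, all $x$ with $\psi(e,x)=\gamma$ and all $L$ with $x\in\mathbb P^{1,\mathrm{an}}_k(L)$: some $W\in\mathcal O_{x_L}$ with $g(h_L(W))=M_g(\gamma)$ splits, and $g(h_L(O))\le M_g(\gamma)$ for every $O\in\mathcal O_{x_L}$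 that splits. *(1.6) for $\phi$:* there are a deformation retraction $\psi$ whose image $\Upsilon$ is a finite simplicial complex and a not identically zero function $M:\Upsilon\to[0,1]$ with $\log M$ piecewise linear, such that for all $\gamma\in\Upsilon$ with $M(\gamma)>0$, all $x$ with $\psi(e,x)=\gamma$ and all $L$ with $x\in\mathbb P^{1,\mathrm{an}}_k(L)$: $B(x_L,M(\gamma))$ splits into balls, and $r\le M(\gamma)$ for every $0<r\le1$ such that $B(x_L,r)$ splits into balls. **Statement.** For every such $k$ and $\phi$, (1.7) for $\phi$ implies (1.6) for $\phi$. The same implication holds between the sharp forms of the two assertions, in which one requires in addition that for $\gamma\in\Upsilon$ with $M_g(\gamma)=0$ (resp. $M(\gamma)=0$), all $x$ with $\psi(e,x)=\gamma$ and all $L$ with $x\in\mathbb P^{1,\mathrm{an}}_k(L)$, no $O\in\mathcal O_{x_L}$ splits (resp. no $B(x_L,r)$ with $0<r\le1$ splits into balls). -/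

import Mathlib

universe u

namespace BerkovichLine

open MvPolynomial

noncomputable section

/-! ### The Berkovich projective line -/

/-- Polynomials in the homogeneous coordinates `T₁ = X 0`, `T₂ = X 1`. -/
abbrev HPoly (K : Type u) [CommSemiring K] : Type u := MvPolynomial (Fin 2) K

/-- Pulling back a multiplicative seminorm along a ring homomorphism. -/
def pullback {A B : Type*} [CommRing A] [CommRing B] (e : A →+* B) (x : MulRingSeminorm B) :
    MulRingSeminorm A where
  toFun f := x (e f)
  map_zero' := by simp
  add_le' f g := by simpa using map_add_le_add x (e f) (e g)
  neg' f := by simp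
  map_one' := by simp
  map_mul' f g := by simp

/-- The norm of a normed field as a multiplicative seminorm. -/
def fieldNorm (L : Type u) [NormedField L] : MulRingSeminorm L where
  toFun a := ‖a‖
  map_zero' := norm_zero
  add_le' := norm_add_le
  neg' := norm_neg
  map_one' := norm_one
  map_mul' := norm_mul

/-- The set of non-Archimedean multiplicative seminorms on `K[T₁, T₂]` which restrict to the given
norm on `K` and at which `T₁`, `T₂` do not both vanish. -/
def Cone (K : Type u) [NormedField K] : Type u :=
  {x : MulRingSeminorm (HPoly K) // IsNonarchimedean x ∧ (∀ c : K, x (C c) = ‖c‖) ∧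
    ¬ (x (X 0) = 0 ∧ x (X 1) = 0)}

/-- The weakest topology for which all the maps `x ↦ |f(x)|` are continuous. -/
instance (K : Type u) [NormedField K] : TopologicalSpace (Cone K) :=
  TopologicalSpace.induced (fun x (f : HPoly K) => x.1 f) inferInstance

/-- `x ∼ y` if there is `c > 0` with `|F(x)| = c ^ deg F * |F(y)|` for all homogeneous `F`. -/
instance coneSetoid (K : Type u) [NormedField K] : Setoid (Cone K) where
  r x y := ∃ c : ℝ, 0 < c ∧ ∀ (d : ℕ) (F : HPoly K), F.IsHomogeneous d → x.1 F = c ^ d * y.1 F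
  iseqv :=
    { refl := fun x => ⟨1, one_pos, fun d F _ => by simp⟩
      symm := by
        rintro x y ⟨c, hc, h⟩
        refine ⟨c⁻¹, inv_pos.2 hc, fun d F hF => ?_⟩
        rw [h d F hF, inv_pow, inv_mul_cancel_left₀ (pow_ne_zero d hc.ne')]
      trans := by
        rintro x y z ⟨c, hc, h⟩ ⟨c', hc', h'⟩
        refine ⟨c * c', mul_pos hc hc', fun d F hF => ?_⟩
        rw [h d F hF, h' d F hF, mul_pow, mul_assoc] }

/-- The Berkovich analytification of the projective line over `K`. -/
def P1an (K : Type u) [NormedField K] : Type u := Quotient (coneSetoid K)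

instance (K : Type u) [NormedField K] : TopologicalSpace (P1an K) :=
  inferInstanceAs (TopologicalSpace (Quotient (coneSetoid K)))

theorem Cone.max_pos {K : Type u} [NormedField K] (x : Cone K) :
    0 < max (x.1 (X 0)) (x.1 (X 1)) := by
  by_contra h
  rw [lt_max_iff, not_or, not_lt, not_lt] at h
  exact x.2.2.2 ⟨le_antisymm h.1 (apply_nonneg _ _), le_antisymm h.2 (apply_nonneg _ _)⟩

/-- For `F` homogeneous of degree `d`, the number `|F(x)| / max (|T₁(x)|, |T₂(x)|) ^ d`, which
depends on the point `x` of the projective line only. (For arbitrary `F`, its homogeneous component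
of degree `d` is meant.) Ratios of these numbers, for forms of equal degree, are the absolute values
at `x` of the corresponding rational functions. -/
def absForm {K : Type u} [NormedField K] (d : ℕ) (F : HPoly K) : P1an K → ℝ :=
  Quotient.lift
    (fun x : Cone K => x.1 (homogeneousComponent d F) / max (x.1 (X 0)) (x.1 (X 1)) ^ d) (by
      rintro x y ⟨c, hc, h⟩
      have h0 := h 1 (X 0) (isHomogeneous_X K 0)
      have h1 := h 1 (X 1) (isHomogeneous_X K 1)
      have hF := h d _ (homogeneousComponent_isHomogeneous d F)
      rw [pow_one] at h0 h1
      simp only [h0, h1, hF]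
      rw [← mul_max_of_nonneg _ _ hc.le, mul_pow,
        mul_div_mul_left _ _ (pow_ne_zero d hc.ne')])

/-! ### Points with values in an extension -/

/-- The seminorm `f ↦ ‖f(v)‖` on `k[T₁, T₂]` attached to a vector `v ≠ 0` over an extension `L`. -/
def evalCone (k L : Type u) [NormedField k] [NormedField L] [IsUltrametricDist L]
    [NormedAlgebra k L] (v : Fin 2 → L) (hv : v ≠ 0) : Cone k :=
  ⟨pullback (aeval v).toRingHom (fieldNorm L), by
    refine ⟨fun f g => ?_, fun c => ?_, fun h => hv ?_⟩
    · change ‖aeval v (f + g)‖ ≤ max ‖aeval v f‖ ‖aeval v g‖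
      rw [map_add]
      exact IsUltrametricDist.norm_add_le_max _ _
    · change ‖aeval v (C c)‖ = ‖c‖
      rw [aeval_C, norm_algebraMap']
    · have h0 : ‖aeval v (X 0 : HPoly k)‖ = 0 := h.1
      have h1 : ‖aeval v (X 1 : HPoly k)‖ = 0 := h.2
      rw [aeval_X, norm_eq_zero] at h0 h1
      funext i
      fin_cases i
      · exact h0
      · exact h1⟩

/-- The point of `P1an k` under the `L`-point `[v 0 : v 1]`. A point `x` of `P1an k` is an `L`-point
if it is of this form; the vector `v` then gives homogeneous coordinates of the closed point `x_L`
of the projective line over `L`. -/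
def pointBelow (k L : Type u) [NormedField k] [NormedField L] [IsUltrametricDist L]
    [NormedAlgebra k L] (v : Fin 2 → L) (hv : v ≠ 0) : P1an k :=
  Quotient.mk _ (evalCone k L v hv)

/-! ### Finite endomorphisms -/

/-- A finite endomorphism `[T₁ : T₂] ↦ [F₀ : F₁]` of the projective line over an algebraically
closed field: two forms of the same positive degree without common zero. -/
structure FiniteEndo (k : Type u) [Field k] where
  F : Fin 2 → HPoly k
  deg : ℕ
  deg_pos : 0 < deg
  homogeneous : ∀ i, (F i).IsHomogeneous deg
  no_common_zero : ∀ v : Fin 2 → k, (∀ i, eval v (F i) = 0) → v = 0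

theorem FiniteEndo.exists_pow_mem {k : Type u} [Field k] [IsAlgClosed k] (φ : FiniteEndo k)
    (i : Fin 2) : ∃ (n : ℕ) (a b : HPoly k), X i ^ n = a * φ.F 0 + b * φ.F 1 := by
  have h : (X i : HPoly k) ∈ (Ideal.span {φ.F 0, φ.F 1}).radical := by
    rw [← vanishingIdeal_zeroLocus_eq_radical (K := k), mem_vanishingIdeal_iff]
    intro v hv
    rw [mem_zeroLocus_iff] at hv
    have hv0 : v = 0 := by
      apply φ.no_common_zero v
      intro j
      have := hv (φ.F j) (Ideal.subset_span (by fin_cases j <;> simp))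
      simpa [aeval_eq_eval] using this
    simp [hv0]
  obtain ⟨n, hn⟩ := h
  obtain ⟨a, b, hab⟩ := Ideal.mem_span_pair.1 hn
  exact ⟨n, a, b, hab.symm⟩

section Endo

variable {k : Type u} [NormedField k] [IsAlgClosed k] (φ : FiniteEndo k)
  (L : Type u) [NormedField L] [NormedAlgebra k L]

/-- The substitution `G ↦ G(F₀, F₁)` on `L[T₁, T₂]`. -/
def FiniteEndo.subst : HPoly L →+* HPoly L :=
  (aeval (fun i => map (algebraMap k L) (φ.F i)) : HPoly L →ₐ[L] HPoly L).toRingHom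

/-- The map induced by `φ` on seminorms, `|G(φ(x))| = |G(F₀, F₁)(x)|`. -/
def FiniteEndo.anCone (x : Cone L) : Cone L :=
  ⟨pullback (φ.subst L) x.1, by
    have hX : ∀ i, pullback (φ.subst L) x.1 (X i) = x.1 (map (algebraMap k L) (φ.F i)) := by
      intro i
      change x.1 (aeval _ (X i)) = _
      rw [aeval_X]
    refine ⟨fun f g => ?_, fun c => ?_, fun h => x.2.2.2 ?_⟩
    · change x.1 (φ.subst L (f + g)) ≤ max (x.1 (φ.subst L f)) (x.1 (φ.subst L g))
      rw [map_add]
      exact x.2.1 _ _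
    · change x.1 (aeval _ (C c)) = _
      rw [aeval_C, algebraMap_eq]
      exact x.2.2.1 c
    · rw [hX, hX] at h
      have key : ∀ i, x.1 (X i) = 0 := by
        intro i
        obtain ⟨n, a, b, hab⟩ := φ.exists_pow_mem i
        have h1 := congrArg (map (algebraMap k L)) hab
        rw [map_pow, map_X, map_add, map_mul, map_mul] at h1
        have h2 : x.1 (X i ^ n) ≤ 0 := by
          rw [h1]
          refine (map_add_le_add x.1 _ _).trans ?_
          rw [map_mul, map_mul, h.1, h.2]
          simp
        have h3 : x.1 (X i) ^ n = 0 := by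
          rw [← map_pow]
          exact le_antisymm h2 (apply_nonneg _ _)
        exact eq_zero_of_pow_eq_zero h3
      exact ⟨key 0, key 1⟩⟩

/-- The analytification `φ_L^an` of the base change of `φ` to the extension `L`. -/
def FiniteEndo.an : P1an L → P1an L :=
  Quotient.map (φ.anCone L) (by
    rintro x y ⟨c, hc, h⟩
    refine ⟨c ^ φ.deg, pow_pos hc _, fun d G hG => ?_⟩
    have hs : (φ.subst L G).IsHomogeneous (φ.deg * d) :=
      hG.aeval _ fun i => (φ.homogeneous i).map _
    rw [← pow_mul]
    exact h _ _ hs)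

end Endo

/-! ### Preimages that decompose into homeomorphic copies -/

/-- `f` restricts to a homeomorphism from `U` onto `W`. -/
def RestrictsToHomeo {X Y : Type*} [TopologicalSpace X] [TopologicalSpace Y] (f : X → Y)
    (U : Set X) (W : Set Y) : Prop :=
  ∃ e : U ≃ₜ W, ∀ u : U, (e u : Y) = f u

/-- The preimage of `W` under `f` is the disjoint union of open sets with the property `P`, each
of which is mapped homeomorphically onto `W` by `f`. -/
def Decomposes {X Y : Type*} [TopologicalSpace X] [TopologicalSpace Y] (f : X → Y)
    (P : Set X → Prop) (W : Set Y) : Prop :=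
  ∃ 𝒰 : Set (Set X), (∀ U ∈ 𝒰, IsOpen U ∧ P U ∧ RestrictsToHomeo f U W) ∧
    𝒰.PairwiseDisjoint id ∧ ⋃₀ 𝒰 = f ⁻¹' W

/-! ### Berkovich open balls -/

section Balls

variable {L : Type u} [NormedField L]

/-- The ball `{|T - a| < r}`, where `T = T₁ / T₂`. -/
def disc (a : L) (r : ℝ) : Set (P1an L) :=
  {p | absForm 1 (X 0 - C a * X 1) p < r * absForm 1 (X 1) p}

/-- The set `{|T - a| > r}`, which contains `∞`. -/
def coDisc (a : L) (r : ℝ) : Set (P1an L) :=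
  {p | r * absForm 1 (X 1) p < absForm 1 (X 0 - C a * X 1) p}

/-- Berkovich open balls of the projective line: the images of the balls `{|T| < r}` under
coordinate changes. -/
def IsOpenBall (U : Set (P1an L)) : Prop :=
  ∃ (a : L) (r : ℝ), 0 < r ∧ (U = disc a r ∨ U = coDisc a r)

/-- The Berkovich open ball of radius `r` around the point `[v 0 : v 1]`: it is `{|T - a| < r}` with
`a = v 0 / v 1` if `v 1 ≠ 0`, and `{|1 / T| < r}` if the point is `∞`. -/
def ballAround (v : Fin 2 → L) (r : ℝ) : Set (P1an L) :=
  open Classical in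
  if v 1 = 0 then {p | absForm 1 (X 1) p < r * absForm 1 (X 0) p} else disc (v 0 / v 1) r

/-- The closed disc `A_t` of the standard cover, where `|T_j / T_t| ≤ 1` for all `j`. -/
def chart (L : Type u) [NormedField L] (t : Fin 2) : Set (P1an L) :=
  {p | ∀ j, absForm 1 (X j) p ≤ absForm 1 (X t) p}

/-- The point `[v 0 : v 1]` lies in `A_t`. -/
def InChart (v : Fin 2 → L) (t : Fin 2) : Prop := ∀ j, ‖v j‖ ≤ ‖v t‖

/-- The subset of `A_t` defined by `|T_j / T_t - v_j / v_t| < ρ_j` for `j ≠ t`. -/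
def chartBall (v : Fin 2 → L) (t : Fin 2) (ρ : Fin 2 → ℝ) : Set (P1an L) :=
  {p | p ∈ chart L t ∧
    ∀ j, j ≠ t → absForm 1 (X j - C (v j / v t) * X t) p < ρ j * absForm 1 (X t) p}

/-- The positive real numbers. -/
abbrev Rpos : Type := {r : ℝ // 0 < r}

/-- `W` belongs to the family `𝒪_x` of Berkovich open balls around `x = [v 0 : v 1]` inside the
discs `A_t` which contain `x`, and `ρ = h_L(W)` is its tuple of radii: if `x ∈ A_t` then
`ρ (t, t) = 1` and `W` is the ball in `A_t` with radii `ρ (t, j) ≤ 1`; if `x ∉ A_t` then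
`ρ (t, j) = 1` for all `j`. -/
def HasPolyradius (v : Fin 2 → L) (W : Set (P1an L)) (ρ : Fin 2 × Fin 2 → Rpos) : Prop :=
  ∀ t, (InChart v t → (ρ (t, t) : ℝ) = 1 ∧ (∀ j, (ρ (t, j) : ℝ) ≤ 1) ∧
      W = chartBall v t fun j => ρ (t, j)) ∧
    (¬ InChart v t → ∀ j, (ρ (t, j) : ℝ) = 1)

end Balls

/-! ### The size functions -/

/-- Function symbols of the language of ordered abelian groups, written multiplicatively. -/
inductive GroupFunc : ℕ → Type
  | one : GroupFunc 0
  | inv : GroupFunc 1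
  | mul : GroupFunc 2

/-- The relation symbol of the language of ordered abelian groups. -/
inductive GroupRel : ℕ → Type
  | le : GroupRel 2

/-- The language of ordered abelian groups. -/
def orderedGroup : FirstOrder.Language := ⟨GroupFunc, GroupRel⟩

/-- The multiplicative ordered abelian group of positive real numbers. -/
instance : orderedGroup.Structure Rpos where
  funMap {_} f := match f with
    | .one => fun _ => 1
    | .inv => fun x => (x 0)⁻¹
    | .mul => fun x => x 0 * x 1
  RelMap {_} R := match R with
    | .le => fun x => x 0 ≤ x 1

/-- The class `S` of continuous monotone functions of the tuple of radii which are definable in the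
language of ordered abelian groups. -/
structure IsSizeFunction (g : (Fin 2 × Fin 2 → Rpos) → Rpos) : Prop where
  continuous : Continuous g
  monotone : Monotone g
  definable : (∅ : Set Rpos).DefinableFun orderedGroup g

/-! ### Finite graphs and piecewise linear functions -/

section Graphs

variable {K : Type u} [NormedField K]

/-- The partial order on the projective line with greatest element `∞`: for points of the affine
line it says `|f(x)| ≤ |f(y)|` for all polynomials `f` in `T`. -/
def Below (x y : P1an K) : Prop :=
  ∀ (d : ℕ) (F : HPoly K), F.IsHomogeneous d →
    absForm d F x * absForm 1 (X 1) y ^ d ≤ absForm d F y * absForm 1 (X 1) x ^ d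

/-- The arc between two comparable points. -/
def segment (p q : P1an K) : Set (P1an K) := {z | Below p z ∧ Below z q}

/-- The radius `inf_a |(T - a)(x)|` of a point of the affine line; its logarithm is the standard
parameter on arcs. At `∞` the value is `0`, by the convention for division by zero. -/
def radius (x : P1an K) : ℝ :=
  ⨅ a : K, absForm 1 (X 0 - C a * X 1) x / absForm 1 (X 1) x

/-- Finite simplicial complexes inside the projective line: finite unions of arcs (which may be
points). -/
def IsFiniteGraph (Υ : Set (P1an K)) : Prop :=
  ∃ S : Finset (P1an K × P1an K), (∀ s ∈ S, Below s.1 s.2) ∧ Υ = ⋃ s ∈ S, segment s.1 s.2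

/-- `log M` is piecewise linear on `Υ`: on each arc in `Υ`, after removal of finitely many radii,
`M` is of the form `c * radius ^ α` with `c ≥ 0` on each remaining interval of radii in `(0, ∞)`.
Here `c = 0` stands for `log M = -∞`. The function need not be continuous. -/
def IsLogPiecewiseLinear (Υ : Set (P1an K)) (M : P1an K → ℝ) : Prop :=
  ∀ p q : P1an K, Below p q → segment p q ⊆ Υ →
    ∃ B : Finset ℝ, ∀ J : Set ℝ, J.OrdConnected → J ⊆ Set.Ioi 0 → Disjoint J (B : Set ℝ) →
      ∃ c α : ℝ, 0 ≤ c ∧ ∀ z ∈ segment p q, radius z ∈ J → M z = c * radius z ^ α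

end Graphs

/-! ### Deformation retractions -/

/-- A deformation retraction of a space onto a subspace which is fixed pointwise at all times, such
that moreover every point and all points of its path have the same final image. -/
structure DefRetraction (X : Type*) [TopologicalSpace X] where
  toFun : unitInterval → X → X
  continuous : Continuous fun z : unitInterval × X => toFun z.1 z.2
  start : ∀ x, toFun 0 x = x
  fixes_image : ∀ t x, toFun t (toFun 1 x) = toFun 1 x
  final : ∀ t x, toFun 1 (toFun t x) = toFun 1 x

/-- The final map of a deformation retraction. -/
def DefRetraction.retract {X : Type*} [TopologicalSpace X] (ψ : DefRetraction X) : X → X :=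
  ψ.toFun 1

/-- The image of a deformation retraction. -/
def DefRetraction.skeleton {X : Type*} [TopologicalSpace X] (ψ : DefRetraction X) : Set X :=
  Set.range ψ.retract

/-! ### The two uniformity statements -/

section Statements

variable {k : Type u} [NormedField k] [IsAlgClosed k]

/-- The preimage of `W` under `φ_L^an` is a disjoint union of open sets homeomorphic to `W`. -/
def FiniteEndo.Splits (φ : FiniteEndo k) (L : Type u) [NormedField L] [NormedAlgebra k L]
    (W : Set (P1an L)) : Prop :=
  Decomposes (φ.an L) (fun _ => True) W

/-- The preimage of `W` under `φ_L^an` is a disjoint union of Berkovich open balls homeomorphic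
to `W`. -/
def FiniteEndo.SplitsIntoBalls (φ : FiniteEndo k) (L : Type u) [NormedField L]
    [NormedAlgebra k L] (W : Set (P1an L)) : Prop :=
  Decomposes (φ.an L) IsOpenBall W

/-- The retraction `ψ` and the function `M` on its image control the maximal size, measured by `g`,
of the members of `𝒪_{x_L}` over which `φ_L^an` splits. -/
structure ControlsPolyradii (φ : FiniteEndo k) (g : (Fin 2 × Fin 2 → Rpos) → Rpos)
    (ψ : DefRetraction (P1an k)) (M : P1an k → ℝ) : Prop where
  finiteGraph : IsFiniteGraph ψ.skeleton
  nonneg : ∀ γ ∈ ψ.skeleton, 0 ≤ M γ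
  not_identically_zero : ∃ γ ∈ ψ.skeleton, M γ ≠ 0
  logPiecewiseLinear : IsLogPiecewiseLinear ψ.skeleton M
  attained : ∀ γ ∈ ψ.skeleton, M γ ≠ 0 → ∀ x, ψ.retract x = γ →
    ∀ (L : Type u) [NormedField L] [IsUltrametricDist L] [CompleteSpace L] [IsAlgClosed L]
      [NormedAlgebra k L] (v : Fin 2 → L) (hv : v ≠ 0), pointBelow k L v hv = x →
      ∃ W ρ, HasPolyradius v W ρ ∧ (g ρ : ℝ) = M γ ∧ φ.Splits L W
  maximal : ∀ γ ∈ ψ.skeleton, M γ ≠ 0 → ∀ x, ψ.retract x = γ →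
    ∀ (L : Type u) [NormedField L] [IsUltrametricDist L] [CompleteSpace L] [IsAlgClosed L]
      [NormedAlgebra k L] (v : Fin 2 → L) (hv : v ≠ 0), pointBelow k L v hv = x →
      ∀ O ρ, HasPolyradius v O ρ → φ.Splits L O → (g ρ : ℝ) ≤ M γ

/-- `M` vanishes only where no member of `𝒪_{x_L}` splits. -/
def SharpPolyradii (φ : FiniteEndo k) (ψ : DefRetraction (P1an k)) (M : P1an k → ℝ) : Prop :=
  ∀ γ ∈ ψ.skeleton, M γ = 0 → ∀ x, ψ.retract x = γ →
    ∀ (L : Type u) [NormedField L] [IsUltrametricDist L] [CompleteSpace L] [IsAlgClosed L]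
      [NormedAlgebra k L] (v : Fin 2 → L) (hv : v ≠ 0), pointBelow k L v hv = x →
      ∀ O ρ, HasPolyradius v O ρ → ¬ φ.Splits L O

/-- The retraction `ψ` and the function `M` on its image control the radius of the largest Berkovich
open ball around `x_L`, of radius at most `1`, over which `φ_L^an` splits. -/
structure ControlsRadii (φ : FiniteEndo k) (ψ : DefRetraction (P1an k)) (M : P1an k → ℝ) :
    Prop where
  finiteGraph : IsFiniteGraph ψ.skeleton
  mem_unitInterval : ∀ γ ∈ ψ.skeleton, M γ ∈ Set.Icc (0 : ℝ) 1
  not_identically_zero : ∃ γ ∈ ψ.skeleton, M γ ≠ 0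
  logPiecewiseLinear : IsLogPiecewiseLinear ψ.skeleton M
  attained : ∀ γ ∈ ψ.skeleton, 0 < M γ → ∀ x, ψ.retract x = γ →
    ∀ (L : Type u) [NormedField L] [IsUltrametricDist L] [CompleteSpace L] [IsAlgClosed L]
      [NormedAlgebra k L] (v : Fin 2 → L) (hv : v ≠ 0), pointBelow k L v hv = x →
      φ.SplitsIntoBalls L (ballAround v (M γ))
  maximal : ∀ γ ∈ ψ.skeleton, 0 < M γ → ∀ x, ψ.retract x = γ →
    ∀ (L : Type u) [NormedField L] [IsUltrametricDist L] [CompleteSpace L] [IsAlgClosed L]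
      [NormedAlgebra k L] (v : Fin 2 → L) (hv : v ≠ 0), pointBelow k L v hv = x →
      ∀ r : ℝ, 0 < r → r ≤ 1 → φ.SplitsIntoBalls L (ballAround v r) → r ≤ M γ

/-- `M` vanishes only where no Berkovich open ball of radius at most `1` around `x_L` splits. -/
def SharpRadii (φ : FiniteEndo k) (ψ : DefRetraction (P1an k)) (M : P1an k → ℝ) : Prop :=
  ∀ γ ∈ ψ.skeleton, M γ = 0 → ∀ x, ψ.retract x = γ →
    ∀ (L : Type u) [NormedField L] [IsUltrametricDist L] [CompleteSpace L] [IsAlgClosed L]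
      [NormedAlgebra k L] (v : Fin 2 → L) (hv : v ≠ 0), pointBelow k L v hv = x →
      ∀ r : ℝ, 0 < r → r ≤ 1 → ¬ φ.SplitsIntoBalls L (ballAround v r)

end Statements

end

end BerkovichLine

namespace BerkovichLine

open MvPolynomial Topology Filter

noncomputable section

/-! ### Gauss norms attached to seminorms -/

/-! The hypothesis is used for one size function only, the smallest entry `minRadius` of the tuple
of radii. Three points then have to be settled.

Comparison of radii. Near a point `T = a`, a chart radius and a `T`-radius differ by the factor
`max(1,|a|)^2`, because `|1/T - 1/a| = |T - a| / (|T||a|)` and `|T| = |a|` on the balls in question;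
at infinity the factor is `1`. For `T`-radius at most `1` the two kinds of balls are the same sets
(`chartBall_eq_ballAround`). Since splitting passes to smaller open sets (`Decomposes.mono`), the
largest splitting `T`-radius is `min(1, M * factor)`.

Balls upstairs. The line is a tree: between two distinct points there is a third one which every
connected set joining them must contain (`exists_separating_point`). A disc has a single boundary
point. If an open piece over a disc had two ends, both would be mapped to that boundary point, and
the images of two branches leading to them would overlap, against injectivity (`false_of_two_ends`).
A piece with one end is a ball (`isOpenBall_of_injOn`), so splitting and splitting into balls agree
over the balls concerned.

A new retraction. The factor depends on `x` through `max(1,|T|)` and need not be constant on the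
fibres of `ψ`. So `ψ` is replaced by the retraction `ψ'` onto the set of points above `0` or above a
lower endpoint of an arc of `Υ`. It preserves `max(1,|T|)` (`den_treeRetraction`), its image
contains `Υ`, and `ψ ∘ ψ' = ψ` (`retract_treeRetraction`). The new function is `γ ↦ min(1, M(ψ γ) *
scale γ)`. Its piecewise linearity reduces to that of `M ∘ ψ` on arcs: along an arc, away from
finitely many radii, one either runs inside a single arc of `Υ` or `ψ` is constant
(`isPiecewiseMonomial_comp_retract`).

All of this is computed in the coordinates `|T₂|` and `|T₁ - a T₂|`, which determine points and
topology because forms over an algebraically closed field factor into linear ones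
(`isInducing_coords`). -/

theorem gaussNorm_mul_seminorm {R : Type*} [CommRing R] (x : MulRingSeminorm R)
    (hx : IsNonarchimedean x) {c : ℝ} (hc : 0 ≤ c) (p q : Polynomial R) :
    (p * q).gaussNorm x c = p.gaussNorm x c * q.gaussNorm x c := by
  rcases hc.eq_or_lt with rfl | hc'
  · simp [Polynomial.mul_coeff_zero]
  refine le_antisymm (Polynomial.gaussNorm_mul_le x hx p q hc) ?_
  obtain ⟨i, hi, hip⟩ := p.exists_min_eq_gaussNorm x hc
  obtain ⟨j, hj, hjq⟩ := q.exists_min_eq_gaussNorm x hc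
  have hp0 := p.gaussNorm_nonneg x hc
  have hq0 := q.gaussNorm_nonneg x hc
  have hpq0 := (p * q).gaussNorm_nonneg x hc
  rcases hp0.eq_or_lt with h | hp
  · rw [← h, zero_mul]; exact hpq0
  rcases hq0.eq_or_lt with h | hq
  · rw [← h, mul_zero]; exact hpq0
  refine le_of_eq_of_le ?_ ((p * q).le_gaussNorm x hc (i + j))
  -- With `i` and `j` the smallest indices attaining the two Gauss norms, the product of these two
  -- coefficients strictly dominates every other contribution to the coefficient of index `i + j`.
  have key : x ((p * q).coeff (i + j)) = x (p.coeff i * q.coeff j) := by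
    rw [Polynomial.coeff_mul, Finset.Nat.sum_antidiagonal_eq_sum_range_succ_mk,
      IsNonarchimedean.apply_sum_eq_of_lt hx (k := i) (by simp) (by simp)]
    · simp
    intro l hl hne
    have hl' : l ≤ i + j := by simpa [Nat.lt_succ_iff] using hl
    obtain ⟨m, hm⟩ := Nat.exists_eq_add_of_le hl'
    simp only [hm, Nat.add_sub_cancel_left]
    have hm2 : i + j - i = j := by omega
    rw [show l + m - i = j by omega, map_mul, map_mul]
    refine lt_of_mul_lt_mul_right ?_ (pow_nonneg hc (i + j))
    have e1 : x (p.coeff l) * x (q.coeff m) * c ^ (i + j)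
        = (x (p.coeff l) * c ^ l) * (x (q.coeff m) * c ^ m) := by rw [hm]; ring
    have e2 : x (p.coeff i) * x (q.coeff j) * c ^ (i + j)
        = p.gaussNorm x c * q.gaussNorm x c := by rw [hi, hj]; ring
    rw [e1, e2]
    rcases lt_or_gt_of_ne hne with h | h
    · calc _ ≤ (x (p.coeff l) * c ^ l) * q.gaussNorm x c := by
            gcongr; exact q.le_gaussNorm x hc m
        _ < _ := mul_lt_mul_of_pos_right (hip l h) hq
    · calc _ ≤ p.gaussNorm x c * (x (q.coeff m) * c ^ m) := by
            gcongr; exact p.le_gaussNorm x hc l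
        _ < _ := mul_lt_mul_of_pos_left (hjq m (by omega)) hp
  rw [key, hi, hj, map_mul]
  ring

/-- The Gauss norm of radius `c` over a non-Archimedean multiplicative seminorm. -/
def gaussSeminorm {R : Type*} [CommRing R] (x : MulRingSeminorm R) (hx : IsNonarchimedean x)
    (c : ℝ) (hc : 0 ≤ c) : MulRingSeminorm (Polynomial R) where
  toFun p := p.gaussNorm x c
  map_zero' := by simp
  add_le' p q := (Polynomial.isNonarchimedean_gaussNorm x hx hc p q).trans
    (max_le_add_of_nonneg (p.gaussNorm_nonneg x hc) (q.gaussNorm_nonneg x hc))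
  neg' p := by
    rw [neg_eq_neg_one_mul, gaussNorm_mul_seminorm x hx hc, ← Polynomial.C_1, ← Polynomial.C_neg,
      Polynomial.gaussNorm_C, map_neg_eq_map, map_one, one_mul]
  map_one' := by rw [← Polynomial.C_1, Polynomial.gaussNorm_C, map_one]
  map_mul' := gaussNorm_mul_seminorm x hx hc

theorem gaussNorm_linear {R : Type*} [CommRing R] (x : MulRingSeminorm R) {c : ℝ} (hc : 0 ≤ c)
    (a b : R) :
    (Polynomial.C a + Polynomial.C b * Polynomial.X).gaussNorm x c = max (x a) (x b * c) := by
  refine le_antisymm ?_ (max_le ?_ ?_)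
  · obtain ⟨i, hi⟩ := Polynomial.exists_eq_gaussNorm x c
      (Polynomial.C a + Polynomial.C b * Polynomial.X)
    rw [hi]
    rcases i with _ | _ | i
    · simp
    · simp
    · simp
  · refine le_of_eq_of_le ?_ (Polynomial.le_gaussNorm x _ hc 0)
    simp
  · refine le_of_eq_of_le ?_ (Polynomial.le_gaussNorm x _ hc 1)
    simp

theorem gaussNorm_eq_sup' {R : Type*} [CommRing R] (x : MulRingSeminorm R) {c : ℝ} (hc : 0 ≤ c)
    (p : Polynomial R) {n : ℕ} (hn : ∀ i, n < i → p.coeff i = 0) :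
    p.gaussNorm x c = (Finset.range (n + 1)).sup' Finset.nonempty_range_add_one
      fun i => x (p.coeff i) * c ^ i := by
  refine le_antisymm ?_ (Finset.sup'_le _ _ fun i _ => p.le_gaussNorm x hc i)
  obtain ⟨i, hi⟩ := p.exists_eq_gaussNorm x c
  rw [hi]
  by_cases h : i ≤ n
  · exact Finset.le_sup' (fun i => x (p.coeff i) * c ^ i) (by simpa [Nat.lt_succ_iff] using h)
  · rw [hn i (not_le.1 h), map_zero, zero_mul]
    exact (by positivity : 0 ≤ x (p.coeff 0) * c ^ 0).trans
      (Finset.le_sup' (fun i => x (p.coeff i) * c ^ i) (by simp))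

/-! ### Homogeneous representatives of points and the topology of the line -/

section Points

variable {K : Type u} [NormedField K]

/-- The point of the cone obtained by substituting polynomials in a new variable `Y` and taking the
Gauss norm in `Y`. -/
def Cone.gauss (e : HPoly K →ₐ[K] Polynomial (HPoly K)) (x : Cone K) (c : ℝ) (hc : 0 ≤ c)
    (h : ¬ ((e (X 0)).gaussNorm x.1 c = 0 ∧ (e (X 1)).gaussNorm x.1 c = 0)) : Cone K :=
  ⟨pullback e.toRingHom (gaussSeminorm x.1 x.2.1 c hc), fun f g => by
    change (e (f + g)).gaussNorm x.1 c ≤ max ((e f).gaussNorm x.1 c) ((e g).gaussNorm x.1 c)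
    rw [map_add]
    exact Polynomial.isNonarchimedean_gaussNorm x.1 x.2.1 hc _ _, fun a => by
    change (e (C a)).gaussNorm x.1 c = _
    have ha : e (C a) = Polynomial.C (C a) := e.commutes a
    rw [ha, Polynomial.gaussNorm_C]
    exact x.2.2.1 a, h⟩

theorem absForm_mk {d : ℕ} {F : HPoly K} (hF : F.IsHomogeneous d) (x : Cone K) :
    absForm d F (Quotient.mk _ x) = x.1 F / max (x.1 (X 0)) (x.1 (X 1)) ^ d := by
  change x.1 (homogeneousComponent d F) / _ = _
  rw [homogeneousComponent_of_mem ((mem_homogeneousSubmodule _ _).2 hF), if_pos rfl]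

/-- The substitution `T_i ↦ T_i Y`. -/
def dilateHom (K : Type u) [NormedField K] : HPoly K →ₐ[K] Polynomial (HPoly K) :=
  aeval fun i => Polynomial.C (X i) * Polynomial.X

theorem dilateHom_apply {d : ℕ} {F : HPoly K} (hF : F.IsHomogeneous d) :
    dilateHom K F = Polynomial.C F * Polynomial.X ^ d := by
  conv_lhs => rw [F.as_sum]
  conv_rhs => rw [F.as_sum]
  rw [map_sum, map_sum, Finset.sum_mul]
  refine Finset.sum_congr rfl fun m hm => ?_
  have hd : m.degree = d := by
    rw [Finsupp.degree_eq_weight_one]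
    exact hF (mem_support_iff.1 hm)
  rw [dilateHom, aeval_monomial, monomial_eq]
  simp only [mul_pow, map_mul, Finsupp.prod, map_prod, map_pow]
  rw [Finset.prod_mul_distrib, Finset.prod_pow_eq_pow_sum, ← hd, Finsupp.degree, mul_assoc]
  rfl

theorem coeff_dilateHom (F : HPoly K) (i : ℕ) :
    (dilateHom K F).coeff i = homogeneousComponent i F := by
  conv_lhs => rw [← sum_homogeneousComponent F]
  rw [map_sum, Polynomial.finsetSum_coeff]
  simp only [dilateHom_apply (homogeneousComponent_isHomogeneous _ F),
    Polynomial.coeff_C_mul_X_pow]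
  rw [Finset.sum_ite_eq]
  split_ifs with h
  · rfl
  · rw [homogeneousComponent_eq_zero]
    simpa [Nat.lt_succ_iff] using h

/-- After the substitution `T_i ↦ T_i Y`, the coefficients in `Y` are the homogeneous components, so
the Gauss norm of radius `1/m` is the maximum of the normalized values of the components. These
depend on the point alone, which gives a canonical section of the quotient map. -/
theorem exists_section (p : P1an K) : ∃ y : Cone K, Quotient.mk _ y = p ∧
    ∀ F : HPoly K, y.1 F = (Finset.range (F.totalDegree + 1)).sup' Finset.nonempty_range_add_one
      fun i => absForm i F p := by
  induction p using Quotient.inductionOn with | _ x => ?_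
  set m := max (x.1 (X 0)) (x.1 (X 1)) with hm
  have hm0 : 0 < m := x.max_pos
  have hom : ∀ {d : ℕ} {F : HPoly K}, F.IsHomogeneous d →
      (dilateHom K F).gaussNorm x.1 m⁻¹ = m⁻¹ ^ d * x.1 F := by
    intro d F hF
    rw [dilateHom_apply hF, Polynomial.C_mul_X_pow_eq_monomial, Polynomial.gaussNorm_monomial,
      mul_comm]
  refine ⟨Cone.gauss (dilateHom K) x m⁻¹ (inv_nonneg.2 hm0.le) ?_, ?_, ?_⟩
  · rw [hom (isHomogeneous_X K 0), hom (isHomogeneous_X K 1)]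
    rintro ⟨h0, h1⟩
    exact x.2.2.2 ⟨by simpa [hm0.ne'] using h0, by simpa [hm0.ne'] using h1⟩
  · exact Quotient.sound ⟨m⁻¹, inv_pos.2 hm0, fun d F hF => hom hF⟩
  · intro F
    change (dilateHom K F).gaussNorm x.1 m⁻¹ = _
    rw [gaussNorm_eq_sup' x.1 (inv_nonneg.2 hm0.le) _ (n := F.totalDegree)]
    · refine Finset.sup'_congr _ rfl fun i _ => ?_
      rw [coeff_dilateHom, inv_pow, ← div_eq_mul_inv]
      rfl
    · intro i hi
      rw [coeff_dilateHom, homogeneousComponent_eq_zero _ _ hi]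

/-- The homogeneous seminorm representing a point, normalized by `max (|T₁|, |T₂|) = 1`. -/
def toCone (p : P1an K) : Cone K := (exists_section p).choose

theorem mk_toCone (p : P1an K) : (Quotient.mk _ (toCone p) : P1an K) = p :=
  (exists_section p).choose_spec.1

theorem toCone_apply (p : P1an K) (F : HPoly K) : (toCone p).1 F =
    (Finset.range (F.totalDegree + 1)).sup' Finset.nonempty_range_add_one
      fun i => absForm i F p := (exists_section p).choose_spec.2 F

theorem continuous_cone_eval (F : HPoly K) : Continuous fun x : Cone K => x.1 F :=
  (continuous_apply F).comp continuous_induced_dom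

theorem continuous_absForm (d : ℕ) (F : HPoly K) : Continuous (absForm d F) := by
  refine Continuous.quotient_lift ?_ _
  refine (continuous_cone_eval _).div₀ (((continuous_cone_eval _).max
    (continuous_cone_eval _)).pow _) fun x => (pow_pos x.max_pos _).ne'

theorem isInducing_absForm :
    Topology.IsInducing fun (p : P1an K) (i : ℕ × HPoly K) => absForm i.1 i.2 p := by
  refine ⟨le_antisymm (continuous_iff_le_induced.1
    (continuous_pi fun i => continuous_absForm i.1 i.2)) ?_⟩
  intro U hU
  have hU' : IsOpen ((Quotient.mk _ : Cone K → P1an K) ⁻¹' U) := hU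
  obtain ⟨V, hV, hVU⟩ := isOpen_induced_iff.1 hU'
  -- Openness in the quotient is read off on the canonical representatives, whose values are finite
  -- maxima of values of `absForm`.
  have hUV : U = (fun p F => (toCone p).1 F) ⁻¹' V := by
    ext p
    have h : (fun F => (toCone p).1 F) ∈ V ↔ (Quotient.mk _ (toCone p) : P1an K) ∈ U :=
      Set.ext_iff.1 hVU (toCone p)
    rw [mk_toCone] at h
    exact h.symm
  rw [hUV]
  refine isOpen_induced_iff.2 ⟨(fun (E : ℕ × HPoly K → ℝ) (F : HPoly K) =>
    (Finset.range (F.totalDegree + 1)).sup' Finset.nonempty_range_add_one fun i => E (i, F)) ⁻¹' V,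
    hV.preimage (continuous_pi fun F => Continuous.finset_sup'_apply _ fun i _ =>
      continuous_apply (i, F)), ?_⟩
  simp only [toCone_apply]
  rfl

end Points

/-! ### Linear coordinates -/

section Coordinates

variable {K : Type u} [NormedField K]

/-- The normalized absolute value `|T₂|` at a point. -/
def den (p : P1an K) : ℝ := absForm 1 (X 1) p

/-- The normalized absolute value `|T₁ - a T₂|` at a point. -/
def lin (a : K) (p : P1an K) : ℝ := absForm 1 (X 0 - C a * X 1) p

/-- The absolute value `|T - a|` at a point of the affine line. -/
def aff (a : K) (p : P1an K) : ℝ := lin a p / den p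

theorem isHomogeneous_linear (a : K) : (X 0 - C a * X 1 : HPoly K).IsHomogeneous 1 := by
  refine (isHomogeneous_X K 0).sub ?_
  simpa using (isHomogeneous_C (Fin 2) a).mul (isHomogeneous_X K 1)

theorem lin_mk (a : K) (x : Cone K) : lin a (Quotient.mk _ x) =
    x.1 (X 0 - C a * X 1) / max (x.1 (X 0)) (x.1 (X 1)) := by
  exact (absForm_mk (isHomogeneous_linear a) x).trans (by rw [pow_one])

theorem den_mk (x : Cone K) : den (Quotient.mk _ x) =
    x.1 (X 1) / max (x.1 (X 0)) (x.1 (X 1)) := by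
  exact (absForm_mk (isHomogeneous_X K 1) x).trans (by rw [pow_one])

theorem absForm_X_zero (p : P1an K) : absForm 1 (X 0) p = lin 0 p := by
  simp [lin]

theorem den_nonneg (p : P1an K) : 0 ≤ den p := by
  rw [← mk_toCone p, den_mk]
  exact div_nonneg (apply_nonneg _ _) (toCone p).max_pos.le

theorem lin_nonneg (a : K) (p : P1an K) : 0 ≤ lin a p := by
  rw [← mk_toCone p, lin_mk]
  exact div_nonneg (apply_nonneg _ _) (toCone p).max_pos.le

theorem max_lin_den (p : P1an K) : max (lin 0 p) (den p) = 1 := by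
  rw [← mk_toCone p, lin_mk, den_mk, map_zero, zero_mul, sub_zero,
    max_div_div_right (toCone p).max_pos.le]
  exact div_self (toCone p).max_pos.ne'

theorem den_le_one (p : P1an K) : den p ≤ 1 := (le_max_right _ _).trans (max_lin_den p).le

theorem lin_zero_le_one (p : P1an K) : lin 0 p ≤ 1 := (le_max_left _ _).trans (max_lin_den p).le

theorem lin_le (a b : K) (p : P1an K) : lin b p ≤ max (lin a p) (‖a - b‖ * den p) := by
  rw [← mk_toCone p, lin_mk, lin_mk, den_mk, ← mul_div_assoc,
    max_div_div_right (toCone p).max_pos.le]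
  refine div_le_div_of_nonneg_right ?_ (toCone p).max_pos.le
  have h := (toCone p).2.1 (X 0 - C a * X 1) (C (a - b) * X 1)
  rw [map_mul, (toCone p).2.2.1] at h
  convert h using 2
  rw [C_sub]
  ring

theorem lin_eq_one_of_den_eq_zero {p : P1an K} (hp : den p = 0) (a : K) : lin a p = 1 := by
  have h0 : lin 0 p = 1 := by
    have := max_lin_den p
    rwa [hp, max_eq_left (lin_nonneg 0 p)] at this
  have h1 := lin_le a 0 p
  have h2 := lin_le 0 a p
  rw [hp, mul_zero, max_eq_left (lin_nonneg _ p), h0] at h1 h2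
  exact le_antisymm h2 h1

theorem den_pos_iff {p : P1an K} : 0 < den p ↔ den p ≠ 0 := (den_nonneg p).lt_iff_ne'

theorem aff_nonneg (a : K) (p : P1an K) : 0 ≤ aff a p := div_nonneg (lin_nonneg a p) (den_nonneg p)

theorem lin_eq_aff {p : P1an K} (hp : den p ≠ 0) (a : K) : lin a p = aff a p * den p :=
  (div_mul_cancel₀ _ hp).symm

theorem aff_le {p : P1an K} (hp : den p ≠ 0) (a b : K) : aff b p ≤ max (aff a p) ‖a - b‖ := by
  have hp' := den_pos_iff.2 hp
  rw [aff, div_le_iff₀ hp', max_mul_of_nonneg _ _ hp'.le, ← lin_eq_aff hp]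
  exact lin_le a b p

theorem norm_sub_le_aff {p : P1an K} (hp : den p ≠ 0) (a b : K) :
    ‖a - b‖ ≤ max (aff a p) (aff b p) := by
  have hp' := den_pos_iff.2 hp
  rw [aff, aff, max_div_div_right hp'.le, le_div_iff₀ hp', ← mk_toCone p, lin_mk, lin_mk, den_mk,
    ← mul_div_assoc, max_div_div_right (toCone p).max_pos.le]
  refine div_le_div_of_nonneg_right ?_ (toCone p).max_pos.le
  have h := (toCone p).2.1 (X 0 - C b * X 1) (-(X 0 - C a * X 1))
  rw [map_neg_eq_map, max_comm] at h
  rw [← (toCone p).2.2.1, ← map_mul]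
  convert h using 2
  rw [C_sub]
  ring

theorem one_div_den {p : P1an K} (hp : den p ≠ 0) : 1 / den p = max 1 (aff 0 p) := by
  have hp' := den_pos_iff.2 hp
  rw [div_eq_iff hp, max_mul_of_nonneg _ _ hp'.le, ← lin_eq_aff hp, one_mul, max_comm, max_lin_den]

theorem continuous_den : Continuous (den : P1an K → ℝ) := continuous_absForm _ _

theorem continuous_lin (a : K) : Continuous (lin a : P1an K → ℝ) := continuous_absForm _ _

/-! ### Increasing the radius of a point -/

/-- The substitution `T₁ ↦ T₁ + Y T₂`. -/
def shiftHom (K : Type u) [NormedField K] : HPoly K →ₐ[K] Polynomial (HPoly K) :=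
  aeval ![Polynomial.C (X 0) + Polynomial.C (X 1) * Polynomial.X, Polynomial.C (X 1)]

theorem shiftHom_linear (a : K) : shiftHom K (X 0 - C a * X 1) =
    Polynomial.C (X 0 - C a * X 1) + Polynomial.C (X 1) * Polynomial.X := by
  have h : (algebraMap K (Polynomial (HPoly K))) a = Polynomial.C (C a) := rfl
  simp only [shiftHom, map_sub, map_mul, aeval_X, aeval_C, h]
  simp only [Matrix.cons_val_zero, Matrix.cons_val_one]
  ring

theorem shiftHom_X_zero : shiftHom K (X 0) =
    Polynomial.C (X 0) + Polynomial.C (X 1) * Polynomial.X := by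
  simpa using shiftHom_linear (0 : K)

theorem shiftHom_X_one : shiftHom K (X 1) = Polynomial.C (X 1) := by
  simp [shiftHom]

/-- The Gauss norm of radius `r` after `T₁ ↦ T₁ + Y T₂`. The denominator `max 1 (r * den p)`
restores the normalization `max(|T₁|,|T₂|) = 1`. -/
theorem exists_up (r : ℝ) (hr : 0 ≤ r) (p : P1an K) : ∃ q : P1an K,
    den q = den p / max 1 (r * den p) ∧
      ∀ a, lin a q = max (lin a p) (r * den p) / max 1 (r * den p) := by
  set x := toCone p with hx
  set m := max (x.1 (X 0)) (x.1 (X 1)) with hm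
  have hm0 : 0 < m := x.max_pos
  let y : Cone K := Cone.gauss (shiftHom K) x r hr (by
    rw [shiftHom_X_zero, shiftHom_X_one, gaussNorm_linear _ hr, Polynomial.gaussNorm_C]
    rintro ⟨h0, h1⟩
    exact x.2.2.2 ⟨le_antisymm ((le_max_left _ _).trans h0.le) (apply_nonneg _ _), h1⟩)
  have hy (a : K) : y.1 (X 0 - C a * X 1) = max (x.1 (X 0 - C a * X 1)) (r * x.1 (X 1)) := by
    change (shiftHom K _).gaussNorm x.1 r = _
    rw [shiftHom_linear, gaussNorm_linear _ hr, mul_comm r]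
  have hy0 : y.1 (X 0) = max (x.1 (X 0)) (r * x.1 (X 1)) := by simpa using hy 0
  have hy1 : y.1 (X 1) = x.1 (X 1) := by
    change (shiftHom K _).gaussNorm x.1 r = _
    rw [shiftHom_X_one, Polynomial.gaussNorm_C]
  have hmy : max (y.1 (X 0)) (y.1 (X 1)) = max 1 (r * den p) * m := by
    rw [hy0, hy1, max_right_comm, max_mul_of_nonneg _ _ hm0.le, one_mul, ← mk_toCone p, den_mk,
      mul_assoc, div_mul_cancel₀ _ hm0.ne']
  have h2 : den p = x.1 (X 1) / m := by rw [← den_mk, mk_toCone]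
  refine ⟨Quotient.mk _ y, ?_, fun a => ?_⟩
  · rw [den_mk, hmy, hy1, mul_comm _ m, ← div_div, ← h2]
  · rw [lin_mk, hmy, hy]
    have h1 : lin a p = x.1 (X 0 - C a * X 1) / m := by rw [← lin_mk, mk_toCone]
    rw [mul_comm _ m, ← div_div, ← max_div_div_right hm0.le, h1, h2, mul_div_assoc]

/-- The point obtained from `p` by increasing its radius to `r`: on the affine line,
`|T - a|` becomes `max |T - a| r`. (For negative `r`, nothing happens.) -/
def up (r : ℝ) (p : P1an K) : P1an K := (exists_up (max r 0) (le_max_right _ _) p).choose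

theorem den_up' (r : ℝ) (p : P1an K) : den (up r p) = den p / max 1 (r * den p) := by
  rw [up, (exists_up (max r 0) (le_max_right _ _) p).choose_spec.1,
    max_mul_of_nonneg _ _ (den_nonneg p), zero_mul, max_left_comm, max_comm (1 : ℝ) 0,
    max_eq_right zero_le_one, max_comm]

theorem lin_up' (r : ℝ) (a : K) (p : P1an K) :
    lin a (up r p) = max (lin a p) (r * den p) / max 1 (r * den p) := by
  rw [up, (exists_up (max r 0) (le_max_right _ _) p).choose_spec.2 a,
    max_mul_of_nonneg _ _ (den_nonneg p), zero_mul, ← max_assoc, ← max_assoc,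
    max_right_comm, max_right_comm (1 : ℝ),
    max_eq_left zero_le_one, max_eq_left (lin_nonneg a p)]

theorem den_up_ne_zero {r : ℝ} {p : P1an K} : den (up r p) ≠ 0 ↔ den p ≠ 0 := by
  rw [den_up', div_ne_zero_iff]
  exact and_iff_left (lt_max_of_lt_left one_pos).ne'

theorem aff_up {p : P1an K} (hp : den p ≠ 0) (r : ℝ) (a : K) :
    aff a (up r p) = max (aff a p) r := by
  have h : 0 < max 1 (r * den p) := lt_max_of_lt_left one_pos
  have hp' := den_pos_iff.2 hp
  rw [aff, den_up', lin_up', div_div_div_cancel_right₀ h.ne', ← max_div_div_right hp'.le,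
    mul_div_cancel_right₀ _ hp, aff]

theorem absForm_of_factors {d : ℕ} {F : HPoly K} (hF : F.IsHomogeneous d) {c : K} {n : ℕ}
    {s : Multiset K} (hd : n + s.card = d)
    (h : F = C c * (X 1) ^ n * (s.map fun a => X 0 - C a * X 1).prod) (p : P1an K) :
    absForm d F p = ‖c‖ * den p ^ n * (s.map fun a => lin a p).prod := by
  set x := toCone p
  rw [← mk_toCone p, absForm_mk hF, h]
  simp only [lin_mk, den_mk]
  rw [map_mul, map_mul, x.2.2.1, map_pow, map_multiset_prod, Multiset.map_map]
  have : (s.map fun a => x.1 (X 0 - C a * X 1) / max (x.1 (X 0)) (x.1 (X 1))).prod =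
      (s.map fun a => x.1 (X 0 - C a * X 1)).prod / max (x.1 (X 0)) (x.1 (X 1)) ^ s.card := by
    rw [Multiset.prod_map_div, Multiset.map_const', Multiset.prod_replicate]
  rw [this, ← hd, div_pow, pow_add]
  simp only [Function.comp_def]
  ring

theorem Below.refl (p : P1an K) : Below p p := fun _ _ _ => le_rfl

end Coordinates

/-! ### Points are determined by their linear coordinates -/

section AlgClosed

variable {K : Type u} [NormedField K] [IsAlgClosed K]

/-- Put `T₂ = 1`, split the resulting polynomial into linear factors and homogenize again. The
exponent `n` is the drop in degree, that is, the order of vanishing at infinity. -/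
theorem exists_linear_factors {d : ℕ} {F : HPoly K} (hF : F.IsHomogeneous d) :
    ∃ (c : K) (n : ℕ) (s : Multiset K), n + s.card = d ∧
      F = C c * (X 1) ^ n * (s.map fun a => X 0 - C a * X 1).prod := by
  set f : Polynomial K := aeval ![Polynomial.X, 1] F with hf
  have hFf : f.homogenize d = F := Polynomial.homogenize_eq_of_isHomogeneous hF hf.symm
  by_cases h0 : f = 0
  · refine ⟨0, d, 0, by simp, ?_⟩
    rw [← hFf, h0]
    simp
  have hdeg : f.natDegree ≤ d := by
    by_contra h
    rw [not_le] at h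
    have h1 : ∀ N, d < N → f.coeff N = 0 := by
      intro N hN
      rw [hf, F.as_sum, map_sum, Polynomial.finsetSum_coeff]
      refine Finset.sum_eq_zero fun m hm => ?_
      have hd : m.degree = d := by
        rw [Finsupp.degree_eq_weight_one]
        exact hF (mem_support_iff.1 hm)
      have hm0 : m 0 ≤ d := hd ▸ Finsupp.le_degree 0 m
      rw [aeval_monomial, Finsupp.prod_fintype _ _ (by simp), Fin.prod_univ_two]
      simp only [Matrix.cons_val_zero, Matrix.cons_val_one, one_pow, mul_one,
        Polynomial.algebraMap_eq, Polynomial.coeff_C_mul, Polynomial.coeff_X_pow]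
      rw [if_neg (by omega), mul_zero]
    exact h0 (Polynomial.leadingCoeff_eq_zero.1 (h1 _ h))
  have hsplit := IsAlgClosed.splits f
  have hcard : f.roots.card = f.natDegree := hsplit.natDegree_eq_card_roots.symm
  refine ⟨f.leadingCoeff, d - f.natDegree, f.roots, by omega, ?_⟩
  have key : ∀ s : Multiset K, ∀ n, (s.map fun a => Polynomial.X - Polynomial.C a).prod.homogenize
      (n + s.card) = X 1 ^ n * (s.map fun a => (X 0 - C a * X 1 : HPoly K)).prod := by
    intro s n
    induction s using Multiset.induction_on with
    | empty => simp
    | cons a s ih =>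
      rw [Multiset.map_cons, Multiset.prod_cons, Multiset.card_cons, ← add_assoc,
        add_comm (n + s.card) 1, Polynomial.homogenize_mul, ih, Multiset.map_cons,
        Multiset.prod_cons]
      · simp only [Polynomial.homogenize_sub, Polynomial.homogenize_X one_ne_zero,
          Polynomial.homogenize_C]
        simp only [tsub_self, pow_zero, pow_one, mul_one]
        ring
      · exact (Polynomial.natDegree_X_sub_C a).le
      · rw [Polynomial.natDegree_multiset_prod_X_sub_C_eq_card]
        omega
  rw [mul_assoc, ← key, hcard, Nat.sub_add_cancel hdeg, ← Polynomial.homogenize_C_mul,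
    ← hsplit.eq_prod_roots, hFf]

theorem exists_absForm_eq (d : ℕ) (F : HPoly K) : ∃ (c : K) (n : ℕ) (s : Multiset K),
    n + s.card = d ∧ ∀ p, absForm d F p = ‖c‖ * den p ^ n * (s.map fun a => lin a p).prod := by
  have hF := homogeneousComponent_isHomogeneous d F
  obtain ⟨c, n, s, hd, h⟩ := exists_linear_factors hF
  refine ⟨c, n, s, hd, fun p => ?_⟩
  rw [← absForm_of_factors hF hd h]
  rw [← mk_toCone p, absForm_mk hF]
  rfl

/-- By linear factorization every `absForm` is a constant times a product of values of `den` and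
`lin`, hence a continuous function of these coordinates. -/
theorem isInducing_coords : Topology.IsInducing fun (p : P1an K) => (den p, fun a => lin a p) := by
  refine ⟨le_antisymm (continuous_iff_le_induced.1
    (continuous_den.prodMk (continuous_pi continuous_lin))) ?_⟩
  rw [isInducing_absForm.eq_induced]
  choose c n s _ h using exists_absForm_eq (K := K)
  have hG : (fun (p : P1an K) (i : ℕ × HPoly K) => absForm i.1 i.2 p) =
      (fun (E : ℝ × (K → ℝ)) (i : ℕ × HPoly K) => ‖c i.1 i.2‖ * E.1 ^ n i.1 i.2 *
        ((s i.1 i.2).map fun a => E.2 a).prod) ∘ fun p => (den p, fun a => lin a p) := by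
    funext p i
    exact h i.1 i.2 p
  rw [hG, ← induced_compose]
  refine induced_mono (continuous_iff_le_induced.1 (continuous_pi fun i => ?_))
  refine (continuous_const.mul (continuous_fst.pow _)).mul
    (continuous_multiset_prod (s i.1 i.2) fun a _ => ?_)
  exact (continuous_apply a).comp continuous_snd

theorem continuous_of_coords {Y : Type*} [TopologicalSpace Y] {f : Y → P1an K}
    (h1 : Continuous fun y => den (f y)) (h2 : ∀ a, Continuous fun y => lin a (f y)) :
    Continuous f :=
  isInducing_coords.continuous_iff.2 (h1.prodMk (continuous_pi h2))

theorem ext_coords {p q : P1an K} (h1 : den p = den q) (h2 : ∀ a, lin a p = lin a q) : p = q := by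
  have h : ∀ d F, absForm d F p = absForm d F q := by
    intro d F
    obtain ⟨c, n, s, -, h⟩ := exists_absForm_eq d F
    simp only [h, h1, h2]
  have hpq : toCone p = toCone q := by
    apply Subtype.ext
    apply DFunLike.ext
    intro F
    simp only [toCone_apply, h]
  rw [← mk_toCone p, hpq, mk_toCone]

theorem eq_of_den_eq_zero {p q : P1an K} (hp : den p = 0) (hq : den q = 0) : p = q :=
  ext_coords (hp.trans hq.symm) fun a => by
    rw [lin_eq_one_of_den_eq_zero hp, lin_eq_one_of_den_eq_zero hq]

theorem ext_aff {p q : P1an K} (hp : den p ≠ 0) (hq : den q ≠ 0) (h : ∀ a, aff a p = aff a q) :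
    p = q := by
  have hd : den p = den q := by
    have := (one_div_den hp).trans ((congrArg (max 1) (h 0)).trans (one_div_den hq).symm)
    simpa using this
  exact ext_coords hd fun a => by rw [lin_eq_aff hp, lin_eq_aff hq, h, hd]

/-- Both sides are multiplicative in the form, so it is enough to compare linear factors; the
factors `X 1` contribute equally to both sides. -/
theorem below_iff {p q : P1an K} : Below p q ↔ ∀ a, lin a p * den q ≤ lin a q * den p := by
  refine ⟨fun h a => by simpa [lin, den] using h 1 _ (isHomogeneous_linear a), fun h d F hF => ?_⟩
  obtain ⟨c, n, s, hd, h'⟩ := exists_absForm_eq d F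
  change absForm d F p * den q ^ d ≤ absForm d F q * den p ^ d
  rw [h', h', ← hd, pow_add, pow_add]
  have key : (s.map fun a => lin a p).prod * den q ^ s.card ≤
      (s.map fun a => lin a q).prod * den p ^ s.card := by
    have e : ∀ p q : P1an K, (s.map fun a => lin a p).prod * den q ^ s.card =
        (s.map fun a => lin a p * den q).prod := by
      intro p q
      rw [Multiset.prod_map_mul, Multiset.map_const', Multiset.prod_replicate]
    rw [e, e]
    refine Multiset.prod_map_le_prod_map₀ _ _ (fun a _ => ?_) fun a _ => h a
    exact mul_nonneg (lin_nonneg _ _) (den_nonneg _)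
  have := mul_le_mul_of_nonneg_left key (a := ‖c‖ * den p ^ n * den q ^ n)
    (by have := den_nonneg p; have := den_nonneg q; positivity)
  linarith

theorem below_iff_aff {p q : P1an K} (hp : den p ≠ 0) (hq : den q ≠ 0) :
    Below p q ↔ ∀ a, aff a p ≤ aff a q := by
  rw [below_iff]
  refine forall_congr' fun a => ?_
  rw [aff, aff, div_le_div_iff₀ (den_pos_iff.2 hp) (den_pos_iff.2 hq)]

theorem below_of_den_eq_zero {p q : P1an K} (hq : den q = 0) : Below p q :=
  below_iff.2 fun a => by
    rw [hq, mul_zero]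
    exact mul_nonneg (lin_nonneg _ _) (den_nonneg _)

theorem Below.den_eq_zero {p q : P1an K} (h : Below p q) (hp : den p = 0) : den q = 0 := by
  have := below_iff.1 h 0
  rw [hp, mul_zero, lin_eq_one_of_den_eq_zero hp, one_mul] at this
  exact le_antisymm this (den_nonneg q)

theorem Below.den_ne_zero {p q : P1an K} (h : Below p q) (hq : den q ≠ 0) : den p ≠ 0 :=
  fun hp => hq (h.den_eq_zero hp)

theorem Below.trans {p q z : P1an K} (h : Below p q) (h' : Below q z) : Below p z := by
  by_cases hz : den z = 0
  · exact below_of_den_eq_zero hz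
  have hq := h'.den_ne_zero hz
  have hp := h.den_ne_zero hq
  rw [below_iff_aff hp hz]
  exact fun a => ((below_iff_aff hp hq).1 h a).trans ((below_iff_aff hq hz).1 h' a)

theorem Below.antisymm {p q : P1an K} (h : Below p q) (h' : Below q p) : p = q := by
  by_cases hq : den q = 0
  · exact eq_of_den_eq_zero (h'.den_eq_zero hq) hq
  have hp := h.den_ne_zero hq
  exact ext_aff hp hq fun a =>
    le_antisymm ((below_iff_aff hp hq).1 h a) ((below_iff_aff hq hp).1 h' a)

theorem continuous_up (p : P1an K) : Continuous fun r => up r p := by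
  have h : ∀ r : ℝ, max 1 (r * den p) ≠ 0 := fun r => (lt_max_of_lt_left one_pos).ne'
  refine continuous_of_coords ?_ fun a => ?_
  · simp only [den_up']
    exact Continuous.div₀ (by fun_prop) (by fun_prop) h
  · simp only [lin_up']
    exact Continuous.div₀ (by fun_prop) (by fun_prop) h

theorem up_zero (p : P1an K) : up 0 p = p :=
  ext_coords (by simp [den_up']) fun a => by simp [lin_up', lin_nonneg]

theorem up_of_den_eq_zero {p : P1an K} (hp : den p = 0) (r : ℝ) : up r p = p :=
  eq_of_den_eq_zero (by simp [den_up', hp]) hp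

end AlgClosed

/-! ### Rational points -/

theorem max_norm_pos {L : Type*} [NormedField L] {v : Fin 2 → L} (hv : v ≠ 0) : 0 < max ‖v 0‖ ‖v 1‖ := by
  by_contra h
  rw [lt_max_iff, not_or, norm_pos_iff, norm_pos_iff, not_not, not_not] at h
  apply hv
  funext i
  fin_cases i
  · exact h.1
  · exact h.2

section RationalPoints

variable {k L : Type u} [NormedField k] [NormedField L] [IsUltrametricDist L] [NormedAlgebra k L]

theorem den_pointBelow (v : Fin 2 → L) (hv : v ≠ 0) :
    den (pointBelow k L v hv) = ‖v 1‖ / max ‖v 0‖ ‖v 1‖ := by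
  have h (i) : (evalCone k L v hv).1 (X i) = ‖v i‖ := by
    change ‖aeval v (X i : HPoly k)‖ = _
    rw [aeval_X]
  refine (den_mk _).trans ?_
  rw [h, h]

theorem lin_pointBelow (v : Fin 2 → L) (hv : v ≠ 0) (a : k) :
    lin a (pointBelow k L v hv) = ‖v 0 - algebraMap k L a * v 1‖ / max ‖v 0‖ ‖v 1‖ := by
  have h (i) : (evalCone k L v hv).1 (X i) = ‖v i‖ := by
    change ‖aeval v (X i : HPoly k)‖ = _
    rw [aeval_X]
  refine (lin_mk _ _).trans ?_
  rw [h, h]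
  congr 1
  change ‖aeval v (X 0 - C a * X 1 : HPoly k)‖ = _
  rw [map_sub, map_mul, aeval_X, aeval_X, aeval_C]

theorem den_pointBelow_ne_zero {v : Fin 2 → L} (hv : v ≠ 0) :
    den (pointBelow k L v hv) ≠ 0 ↔ v 1 ≠ 0 := by
  rw [den_pointBelow, div_ne_zero_iff, norm_ne_zero_iff]
  exact and_iff_left (max_norm_pos hv).ne'

theorem aff_pointBelow {v : Fin 2 → L} (hv : v ≠ 0) (h1 : v 1 ≠ 0) (a : k) :
    aff a (pointBelow k L v hv) = ‖v 0 / v 1 - algebraMap k L a‖ := by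
  rw [aff, den_pointBelow, lin_pointBelow, div_div_div_cancel_right₀ (max_norm_pos hv).ne',
    ← norm_div, sub_div, mul_div_cancel_right₀ _ h1]

end RationalPoints

/-! ### Existence of the point at infinity and of rational points -/

section Infinity

variable (K : Type u) [NormedField K] [IsUltrametricDist K]

theorem exists_den_eq_zero : ∃ p : P1an K, den p = 0 := by
  have hv : (![1, 0] : Fin 2 → K) ≠ 0 := fun h => one_ne_zero (congrFun h 0)
  exact ⟨pointBelow K K _ hv, not_not.1 fun h => (den_pointBelow_ne_zero hv).1 h rfl⟩

variable {K}

theorem exists_aff_eq_norm (a : K) : ∃ p : P1an K, den p ≠ 0 ∧ ∀ b, aff b p = ‖a - b‖ := by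
  have h1 : (![a, 1] : Fin 2 → K) 1 ≠ 0 := one_ne_zero
  have hv : (![a, 1] : Fin 2 → K) ≠ 0 := fun h => h1 (congrFun h 1)
  refine ⟨pointBelow K K _ hv, (den_pointBelow_ne_zero hv).2 h1, fun b => ?_⟩
  rw [aff_pointBelow hv h1]
  simp

end Infinity

/-! ### Discs and their boundary points -/

section Discs

variable {K : Type u} [NormedField K]

theorem mem_disc {a : K} {r : ℝ} {p : P1an K} : p ∈ disc a r ↔ den p ≠ 0 ∧ aff a p < r := by
  change lin a p < r * den p ↔ _
  by_cases hp : den p = 0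
  · simp [hp, lin_eq_one_of_den_eq_zero hp, zero_le_one]
  · rw [aff, div_lt_iff₀ (den_pos_iff.2 hp)]
    simp [hp]

theorem mem_coDisc {a : K} {r : ℝ} {p : P1an K} :
    p ∈ coDisc a r ↔ (den p ≠ 0 → r < aff a p) := by
  change r * den p < lin a p ↔ _
  by_cases hp : den p = 0
  · simp [hp, lin_eq_one_of_den_eq_zero hp]
  · rw [aff, lt_div_iff₀ (den_pos_iff.2 hp)]
    simp [hp]

theorem isOpen_disc (a : K) (r : ℝ) : IsOpen (disc a r) :=
  isOpen_lt (continuous_lin a) (continuous_const.mul continuous_den)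

theorem isOpen_coDisc (a : K) (r : ℝ) : IsOpen (coDisc a r) :=
  isOpen_lt (continuous_const.mul continuous_den) (continuous_lin a)

/-- The point `z` is the Gauss point of the closed disc of radius `r` around `a`. -/
def IsGaussPoint (a : K) (r : ℝ) (z : P1an K) : Prop := den z ≠ 0 ∧ ∀ b, aff b z = max ‖a - b‖ r

theorem IsGaussPoint.aff_self {a : K} {r : ℝ} (hr : 0 ≤ r) {z : P1an K} (h : IsGaussPoint a r z) :
    aff a z = r := by
  rw [h.2, sub_self, norm_zero, max_eq_right hr]

theorem isGaussPoint_up {p : P1an K} (hp : den p ≠ 0) {a : K} {r : ℝ} (h : aff a p ≤ r) :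
    IsGaussPoint a r (up r p) := by
  refine ⟨den_up_ne_zero.2 hp, fun b => ?_⟩
  rw [aff_up hp]
  have h1 := aff_le hp a b
  have h2 := norm_sub_le_aff hp a b
  apply le_antisymm <;> grind

theorem closure_disc_subset (a : K) (r : ℝ) : closure (disc a r) ⊆ {z | lin a z ≤ r * den z} :=
  closure_minimal
    (fun z (h : lin a z < r * den z) => show lin a z ≤ r * den z from h.le)
    (isClosed_le (continuous_lin a) (continuous_const.mul continuous_den))

theorem closure_coDisc_subset (a : K) (r : ℝ) :
    closure (coDisc a r) ⊆ {z | r * den z ≤ lin a z} :=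
  closure_minimal
    (fun z (h : r * den z < lin a z) => show r * den z ≤ lin a z from h.le)
    (isClosed_le (continuous_const.mul continuous_den) (continuous_lin a))

theorem isGaussPoint_of_mem_frontier_disc {a : K} {r : ℝ} {z : P1an K}
    (hz : z ∈ frontier (disc a r)) : IsGaussPoint a r z := by
  have hzc : z ∈ closure (disc a r) := frontier_subset_closure hz
  have h1 : lin a z ≤ r * den z := closure_disc_subset a r hzc
  have hn : z ∉ disc a r := by
    rw [(isOpen_disc a r).frontier_eq] at hz
    exact hz.2
  have h0 : den z ≠ 0 := by
    intro h
    rw [h, mul_zero, lin_eq_one_of_den_eq_zero h] at h1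
    exact absurd h1 (not_le.2 one_pos)
  have h2 : aff a z = r := by
    refine le_antisymm ((div_le_iff₀ (den_pos_iff.2 h0)).2 h1) ?_
    by_contra h
    exact hn (mem_disc.2 ⟨h0, not_le.1 h⟩)
  refine ⟨h0, fun b => ?_⟩
  have h3 := aff_le h0 a b
  rw [h2, max_comm] at h3
  refine le_antisymm h3 (le_of_not_gt fun hlt => ?_)
  have h4 := norm_sub_le_aff h0 a b
  have h5 := aff_le h0 b a
  rw [norm_sub_rev] at h5
  rw [h2] at h4 h5
  have h6 : aff b z < r := by grind
  have h7 : ‖a - b‖ = r := by grind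
  -- If `z` were not the Gauss point, it would lie in an open disc of radius `r` around some `b`
  -- with `|a - b| = r`. This neighbourhood of `z` is disjoint from `disc a r`.
  obtain ⟨w, hw1, hw2⟩ := mem_closure_iff.1 hzc _ (isOpen_disc b r) (mem_disc.2 ⟨h0, h6⟩)
  rw [mem_disc] at hw1 hw2
  have h8 := norm_sub_le_aff hw1.1 a b
  grind

theorem isGaussPoint_of_mem_frontier_coDisc {a : K} {r : ℝ} {z : P1an K}
    (hz : z ∈ frontier (coDisc a r)) : IsGaussPoint a r z := by
  have hzc : z ∈ closure (coDisc a r) := frontier_subset_closure hz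
  have h1 : r * den z ≤ lin a z := closure_coDisc_subset a r hzc
  have hn : z ∉ coDisc a r := by
    rw [(isOpen_coDisc a r).frontier_eq] at hz
    exact hz.2
  rw [mem_coDisc, Classical.not_imp, not_lt] at hn
  have h0 : den z ≠ 0 := hn.1
  have h2 : aff a z = r := le_antisymm hn.2 ((le_div_iff₀ (den_pos_iff.2 h0)).2 h1)
  refine ⟨h0, fun b => ?_⟩
  have h3 := aff_le h0 a b
  rw [h2, max_comm] at h3
  refine le_antisymm h3 (le_of_not_gt fun hlt => ?_)
  have h4 := norm_sub_le_aff h0 a b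
  have h5 := aff_le h0 b a
  rw [norm_sub_rev] at h5
  rw [h2] at h4 h5
  have h6 : aff b z < r := by grind
  have h7 : ‖a - b‖ = r := by grind
  -- As before, `z` would lie in a disc of radius `r` around some `b` with `|a - b| = r`, on which
  -- `|T - a| ≤ r`.
  obtain ⟨w, hw1, hw2⟩ := mem_closure_iff.1 hzc _ (isOpen_disc b r) (mem_disc.2 ⟨h0, h6⟩)
  rw [mem_disc] at hw1
  have h8 := aff_le hw1.1 b a
  have h9 := mem_coDisc.1 hw2 hw1.1
  rw [norm_sub_rev] at h8
  grind

/-- A connected set meeting both a disc and its complement meets the frontier of the disc, which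
contains no point other than the Gauss point. -/
theorem exists_isGaussPoint_mem {a : K} {r : ℝ} {S : Set (P1an K)} (hS : IsPreconnected S)
    {x y : P1an K} (hx : x ∈ S) (hy : y ∈ S) (hxr : x ∈ disc a r) (hyr : y ∉ disc a r) :
    ∃ z ∈ S, IsGaussPoint a r z := by
  by_contra hcon
  have hfr : ∀ z ∈ S, z ∉ frontier (disc a r) := fun z hz h =>
    hcon ⟨z, hz, isGaussPoint_of_mem_frontier_disc h⟩
  obtain ⟨z, hz, hz1, hz2⟩ := hS (disc a r) (closure (disc a r))ᶜ (isOpen_disc a r)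
    isClosed_closure.isOpen_compl (fun z hz => by
      by_cases h : z ∈ disc a r
      · exact Or.inl h
      · refine Or.inr fun hc => hfr z hz ?_
        rw [(isOpen_disc a r).frontier_eq]
        exact ⟨hc, h⟩) ⟨x, hx, hxr⟩ ⟨y, hy, fun hc => hfr y hy (by
        rw [(isOpen_disc a r).frontier_eq]
        exact ⟨hc, hyr⟩)⟩
  exact hz2 (subset_closure hz1)

theorem radius_eq (p : P1an K) : radius p = ⨅ a, aff a p := rfl

theorem radius_le (p : P1an K) (a : K) : radius p ≤ aff a p :=
  ciInf_le ⟨0, by rintro _ ⟨a, rfl⟩; exact aff_nonneg a p⟩ a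

theorem exists_aff_lt {p : P1an K} {r : ℝ} (h : radius p < r) : ∃ a, aff a p < r :=
  exists_lt_of_ciInf_lt h

variable [IsAlgClosed K]

theorem IsGaussPoint.eq {a : K} {r : ℝ} {z w : P1an K} (hz : IsGaussPoint a r z)
    (hw : IsGaussPoint a r w) : z = w :=
  ext_aff hz.1 hw.1 fun b => by rw [hz.2, hw.2]

theorem IsGaussPoint.mem {a : K} {r : ℝ} {g : P1an K} (hg : IsGaussPoint a r g)
    {S : Set (P1an K)} (hS : IsPreconnected S) {x y : P1an K} (hx : x ∈ S) (hy : y ∈ S)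
    (hxr : x ∈ disc a r) (hyr : y ∉ disc a r) : g ∈ S := by
  obtain ⟨z, hz, hzg⟩ := exists_isGaussPoint_mem hS hx hy hxr hyr
  rwa [hg.eq hzg]

theorem IsGaussPoint.below_iff {a : K} {r : ℝ} (hr : 0 ≤ r) {g : P1an K} (hg : IsGaussPoint a r g)
    {w : P1an K} : Below w g ↔ den w ≠ 0 ∧ aff a w ≤ r := by
  refine ⟨fun h => ?_, fun ⟨h0, h⟩ => ?_⟩
  · have h0 := h.den_ne_zero hg.1
    refine ⟨h0, ?_⟩
    have := (below_iff_aff h0 hg.1).1 h a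
    rwa [hg.aff_self hr] at this
  · rw [below_iff_aff h0 hg.1]
    intro b
    have h1 := aff_le h0 a b
    rw [hg.2]
    grind

theorem isGaussPoint_of_below {z y : P1an K} (h : Below z y) (hy : den y ≠ 0) {a : K}
    (ha : aff a z < aff a y) : IsGaussPoint a (aff a y) y := by
  refine ⟨hy, fun b => ?_⟩
  have hz := h.den_ne_zero hy
  have h1 := aff_le hy a b
  have h2 := aff_le hy b a
  have h3 := norm_sub_le_aff hz a b
  have h4 := (below_iff_aff hz hy).1 h b
  rw [norm_sub_rev] at h2
  apply le_antisymm <;> grind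

/-- A finite point strictly above another one is the Gauss point of a disc containing the latter.
This turns strict order relations into discs that paths have to leave through a known point. -/
theorem exists_isGaussPoint_of_below {z y : P1an K} (h : Below z y) (hy : den y ≠ 0) (hne : z ≠ y) :
    ∃ (a : K) (r : ℝ), 0 < r ∧ IsGaussPoint a r y ∧ z ∈ disc a r := by
  have hz := h.den_ne_zero hy
  have hle := (below_iff_aff hz hy).1 h
  obtain ⟨a, ha⟩ : ∃ a, aff a z < aff a y := by
    by_contra hcon
    push Not at hcon
    exact hne (ext_aff hz hy fun a => le_antisymm (hle a) (hcon a))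
  exact ⟨a, aff a y, (aff_nonneg a z).trans_lt ha, isGaussPoint_of_below h hy ha,
    mem_disc.2 ⟨hz, ha⟩⟩

theorem below_up (r : ℝ) (p : P1an K) : Below p (up r p) := by
  by_cases hp : den p = 0
  · rw [up_of_den_eq_zero hp]
    exact Below.refl p
  rw [below_iff_aff hp (den_up_ne_zero.2 hp)]
  intro a
  rw [aff_up hp]
  exact le_max_left _ _

/-- A finite point above `p` is therefore determined by its radius: it is `p` with the radius
increased. Centres `a` with `|T - a|` at `z` close to the infimum give the upper bound. -/
theorem aff_eq_max_radius {p z : P1an K} (h : Below p z) (hz : den z ≠ 0) (b : K) :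
    aff b z = max (aff b p) (radius z) := by
  have hp := h.den_ne_zero hz
  have hle := (below_iff_aff hp hz).1 h
  refine le_antisymm ?_ (max_le (hle b) (radius_le z b))
  refine le_of_forall_gt_imp_ge_of_dense fun t ht => ?_
  obtain ⟨a, ha⟩ := exists_aff_lt ((le_max_right _ _).trans_lt ht)
  have h1 := aff_le hz a b
  have h2 := norm_sub_le_aff hp a b
  have h3 := hle a
  grind

theorem tendsto_up {p : P1an K} (hp : den p ≠ 0) {q : P1an K} (hq : den q = 0) :
    Tendsto (fun r => up r p) atTop (𝓝 q) := by
  have hp' := den_pos_iff.2 hp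
  have hev : ∀ᶠ r : ℝ in atTop, 1 ≤ r * den p := by
    filter_upwards [eventually_ge_atTop (1 / den p)] with r hr
    rwa [div_le_iff₀ hp'] at hr
  rw [isInducing_coords.tendsto_nhds_iff]
  refine Tendsto.prodMk_nhds ?_ (tendsto_pi_nhds.2 fun a => ?_)
  · rw [hq]
    refine Tendsto.congr' ?_ (tendsto_inv_atTop_zero (𝕜 := ℝ))
    filter_upwards [hev, eventually_gt_atTop 0] with r hr hr0
    simp only [den_up', max_eq_right hr]
    field_simp
  · rw [lin_eq_one_of_den_eq_zero hq]
    refine Tendsto.congr' ?_ tendsto_const_nhds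
    filter_upwards [hev, eventually_ge_atTop (lin a p / den p)] with r hr hr0
    rw [div_le_iff₀ hp'] at hr0
    simp only [lin_up', max_eq_right hr, max_eq_right hr0]
    rw [div_self (by linarith)]

theorem isPreconnected_up (p : P1an K) {I : Set ℝ} (hI : I.OrdConnected) :
    IsPreconnected ((fun r => up r p) '' I) :=
  hI.isPreconnected.image _ (continuous_up p).continuousOn

theorem mem_closure_up {p : P1an K} (hp : den p ≠ 0) {q : P1an K} (hq : den q = 0) (r : ℝ) :
    q ∈ closure ((fun r => up r p) '' Set.Ici r) :=
  mem_closure_of_tendsto (tendsto_up hp hq)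
    ((eventually_ge_atTop r).mono fun s hs => ⟨s, hs, rfl⟩)

/-- Some `|T - a|` distinguishes the two points; the Gauss point of a disc around `a` with radius
strictly between the two values lies on every connected set joining them. -/
theorem exists_separating_point {c z : P1an K} (hne : c ≠ z) : ∃ d, d ≠ c ∧ d ≠ z ∧
    ∀ S : Set (P1an K), IsPreconnected S → c ∈ S → z ∈ S → d ∈ S := by
  have key : ∀ {c z : P1an K} {a : K}, lin a c * den z < lin a z * den c → ∃ d, d ≠ c ∧ d ≠ z ∧
      ∀ S : Set (P1an K), IsPreconnected S → c ∈ S → z ∈ S → d ∈ S := by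
    intro c z a h
    have hc : den c ≠ 0 := by
      intro hc
      rw [hc, mul_zero] at h
      exact absurd h (not_lt.2 (mul_nonneg (lin_nonneg _ _) (den_nonneg _)))
    obtain ⟨r, hr, hrz⟩ : ∃ r, aff a c < r ∧ (den z ≠ 0 → r < aff a z) := by
      by_cases hz : den z = 0
      · exact ⟨aff a c + 1, by linarith, fun h => (h hz).elim⟩
      · obtain ⟨r, h1, h2⟩ := exists_between
          ((div_lt_div_iff₀ (den_pos_iff.2 hc) (den_pos_iff.2 hz)).2 h)
        exact ⟨r, h1, fun _ => h2⟩
    have hg := isGaussPoint_up hc hr.le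
    have hr0 := (aff_nonneg a c).trans hr.le
    have hga := hg.aff_self hr0
    refine ⟨up r c, fun h => ?_, fun h => ?_, fun S hS hcS hzS => hg.mem hS hcS hzS
      (mem_disc.2 ⟨hc, hr⟩) fun hz => ?_⟩
    · rw [h] at hga
      exact hr.ne hga
    · rw [h] at hga hg
      exact (hrz hg.1).ne' hga
    · rw [mem_disc] at hz
      exact (hrz hz.1).not_gt hz.2
  by_cases hcz : ∃ a, lin a c * den z < lin a z * den c
  · exact key hcz.choose_spec
  by_cases hzc : ∃ a, lin a z * den c < lin a c * den z
  · obtain ⟨d, h1, h2, h3⟩ := key hzc.choose_spec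
    exact ⟨d, h2, h1, fun S hS hc hz => h3 S hS hz hc⟩
  push Not at hcz hzc
  exact (hne (Below.antisymm (below_iff.2 hzc) (below_iff.2 hcz))).elim

variable [IsUltrametricDist K]

/-- Each point is joined to infinity by the path of increasing radius, whose closure contains the
point at infinity. -/
theorem isPreconnected_of_up_mem {S : Set (P1an K)} (h : ∀ p ∈ S, ∀ r, 0 ≤ r → up r p ∈ S)
    (h' : ∀ p, den p = 0 → p ∈ S) : IsPreconnected S := by
  obtain ⟨q, hq⟩ := exists_den_eq_zero K
  refine isPreconnected_of_forall q fun p hp => ?_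
  by_cases hp0 : den p = 0
  · rw [eq_of_den_eq_zero hp0 hq]
    exact ⟨{q}, by simpa using h' q hq, rfl, rfl, isPreconnected_singleton⟩
  refine ⟨insert q ((fun r => up r p) '' Set.Ici 0), ?_, Set.mem_insert _ _,
    Set.mem_insert_of_mem _ ⟨0, Set.self_mem_Ici, up_zero p⟩, ?_⟩
  · rw [Set.insert_subset_iff]
    refine ⟨h' q hq, ?_⟩
    rintro _ ⟨r, hr, rfl⟩
    exact h p hp r hr
  · exact (isPreconnected_up p Set.ordConnected_Ici).subset_closure (Set.subset_insert _ _)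
      (Set.insert_subset (mem_closure_up hp0 hq 0) subset_closure)

theorem isPreconnected_coDisc (a : K) (r : ℝ) : IsPreconnected (coDisc a r) := by
  refine isPreconnected_of_up_mem (fun p hp s _ => ?_) fun p hp => mem_coDisc.2 fun h => (h hp).elim
  refine mem_coDisc.2 fun h0 => ?_
  have h1 := den_up_ne_zero.1 h0
  rw [aff_up h1]
  exact lt_max_of_lt_left (mem_coDisc.1 hp h1)

instance : PreconnectedSpace (P1an K) :=
  ⟨isPreconnected_of_up_mem (fun _ _ _ _ => Set.mem_univ _) fun _ _ => Set.mem_univ _⟩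

theorem isPreconnected_disc (a : K) (r : ℝ) : IsPreconnected (disc a r) := by
  obtain ⟨o, ho, hoa⟩ := exists_aff_eq_norm a
  have hoa' : aff a o = 0 := by rw [hoa, sub_self, norm_zero]
  refine isPreconnected_of_forall o fun p hp => ?_
  have hp' := mem_disc.1 hp
  have key : ∀ q, den q ≠ 0 → aff a q ≤ aff a p →
      (fun r => up r q) '' Set.Icc 0 (aff a p) ⊆ disc a r := by
    rintro q hq hqp _ ⟨s, hs, rfl⟩
    refine mem_disc.2 ⟨den_up_ne_zero.2 hq, ?_⟩
    rw [aff_up hq]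
    exact (max_le hqp hs.2).trans_lt hp'.2
  have h0 := aff_nonneg a p
  refine ⟨(fun r => up r o) '' Set.Icc 0 (aff a p) ∪ (fun r => up r p) '' Set.Icc 0 (aff a p),
    Set.union_subset (key o ho (hoa' ▸ h0)) (key p hp'.1 le_rfl),
    Or.inl ⟨0, Set.left_mem_Icc.2 h0, up_zero o⟩, Or.inr ⟨0, Set.left_mem_Icc.2 h0, up_zero p⟩, ?_⟩
  refine IsPreconnected.union (up (aff a p) p) ⟨aff a p, Set.right_mem_Icc.2 h0, ?_⟩
    ⟨aff a p, Set.right_mem_Icc.2 h0, rfl⟩ (isPreconnected_up o Set.ordConnected_Icc)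
    (isPreconnected_up p Set.ordConnected_Icc)
  exact (isGaussPoint_up ho (hoa' ▸ h0)).eq (isGaussPoint_up hp'.1 le_rfl)

end Discs

/-! ### Homeomorphic preimages of discs are discs -/

section OpenBalls

variable {K : Type u} [NormedField K]

variable {f : P1an K → P1an K} {U W : Set (P1an K)} {z : P1an K}

theorem eq_of_mem_closure_of_notMem (hf : Continuous f) (hmaps : Set.MapsTo f U W)
    (hclosed : closure U ∩ f ⁻¹' W ⊆ U) (hW : IsOpen W) (hz : frontier W ⊆ {z}) {y : P1an K}
    (hy : y ∈ closure U) (hyU : y ∉ U) : f y = z := by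
  apply hz
  rw [hW.frontier_eq]
  exact ⟨map_mem_closure hf hy hmaps, fun h => hyU (hclosed ⟨hy, h⟩)⟩

variable [IsAlgClosed K]

/-- By compactness there is a greatest radius in `[0, r]` at which the path upwards from `w` is
outside the open set `U`; above it the path stays in `U` up to radius `r`. -/
theorem exists_last_exit {U : Set (P1an K)} (hU : IsOpen U) {w : P1an K} {r : ℝ} (hr : 0 ≤ r)
    (hw : w ∉ U) (hrU : up r w ∈ U) : ∃ s, 0 ≤ s ∧ s < r ∧ up s w ∉ U ∧
      (∀ t, s < t → t ≤ r → up t w ∈ U) ∧ up s w ∈ closure ((fun t => up t w) '' Set.Ioc s r) := by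
  have hc : IsCompact (Set.Icc 0 r ∩ (fun t => up t w) ⁻¹' Uᶜ) :=
    isCompact_Icc.inter_right (hU.isClosed_compl.preimage (continuous_up w))
  obtain ⟨s, ⟨⟨hs0, hsr⟩, hsU⟩, hmax⟩ := hc.exists_isGreatest
    ⟨0, Set.left_mem_Icc.2 hr, by simpa [up_zero] using hw⟩
  have hlt : s < r := lt_of_le_of_ne hsr fun h => hsU (h ▸ hrU)
  refine ⟨s, hs0, hlt, hsU, fun t hst htr => ?_, ?_⟩
  · by_contra h
    exact absurd (hmax ⟨⟨hs0.trans hst.le, htr⟩, h⟩) (not_le.2 hst)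
  · refine image_closure_subset_closure_image (continuous_up w) ⟨s, ?_, rfl⟩
    rw [closure_Ioc hlt.ne]
    exact Set.left_mem_Icc.2 hlt.le

/-- Both ends are mapped to `z`, while `f c` is in `W` and so differs from `z`. The images of the
two branches both join `f c` to `z`, hence share a separating point `d`. By injectivity its
preimages on the two branches coincide, so they equal `c`; but `d ≠ f c`. -/
theorem false_of_two_ends (hf : Continuous f) (hinj : Set.InjOn f U) (hmaps : Set.MapsTo f U W)
    (hclosed : closure U ∩ f ⁻¹' W ⊆ U) (hW : IsOpen W) (hz : frontier W ⊆ {z})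
    {R₁ R₂ : Set (P1an K)} (h₁ : IsPreconnected R₁) (h₂ : IsPreconnected R₂) (hR₁ : R₁ ⊆ U)
    (hR₂ : R₂ ⊆ U) {c : P1an K} (hc₁ : c ∈ R₁) (hc₂ : c ∈ R₂) (hR : ∀ x ∈ R₁, x ∈ R₂ → x = c)
    {y₁ y₂ : P1an K} (hy₁ : y₁ ∈ closure R₁) (hy₂ : y₂ ∈ closure R₂) (hy₁U : y₁ ∉ U)
    (hy₂U : y₂ ∉ U) : False := by
  have e₁ : f y₁ = z :=
    eq_of_mem_closure_of_notMem hf hmaps hclosed hW hz (closure_mono hR₁ hy₁) hy₁U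
  have e₂ : f y₂ = z :=
    eq_of_mem_closure_of_notMem hf hmaps hclosed hW hz (closure_mono hR₂ hy₂) hy₂U
  have hne : f c ≠ z := by
    intro h
    refine hy₁U (hclosed ⟨closure_mono hR₁ hy₁, ?_⟩)
    rw [Set.mem_preimage, e₁, ← h]
    exact hmaps (hR₁ hc₁)
  obtain ⟨d, hdc, hdz, hd⟩ := exists_separating_point hne
  have key : ∀ {R : Set (P1an K)} {y : P1an K}, IsPreconnected R → c ∈ R → y ∈ closure R →
      f y = z → ∃ x ∈ R, f x = d := by
    intro R y hR hc hy e
    have h3 : IsPreconnected (f '' insert y R) :=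
      (hR.subset_closure (Set.subset_insert _ _)
        (Set.insert_subset hy subset_closure)).image f hf.continuousOn
    obtain ⟨x, hx, hxd⟩ := hd _ h3 ⟨c, Set.mem_insert_of_mem _ hc, rfl⟩ ⟨y, Set.mem_insert _ _, e⟩
    rcases hx with rfl | hx
    · exact (hdz (hxd.symm.trans e)).elim
    · exact ⟨x, hx, hxd⟩
  obtain ⟨x₁, hx₁, hd₁⟩ := key h₁ hc₁ hy₁ e₁
  obtain ⟨x₂, hx₂, hd₂⟩ := key h₂ hc₂ hy₂ e₂
  have hx : x₁ = x₂ := hinj (hR₁ hx₁) (hR₂ hx₂) (hd₁.trans hd₂.symm)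
  rw [hR x₁ hx₁ (hx ▸ hx₂)] at hd₁
  exact hdc hd₁.symm

/-- An open connected subset of the projective line which is mapped injectively to a set `W` with
one boundary point, and which is relatively closed in the preimage of `W`, is a Berkovich open ball,
if some rational point lies outside its closure. -/
theorem isOpenBall_of_injOn [IsUltrametricDist K] (hf : Continuous f) (hU : IsOpen U) (hUne : U.Nonempty)
    (hUc : IsPreconnected U) (hinj : Set.InjOn f U) (hmaps : Set.MapsTo f U W)
    (hclosed : closure U ∩ f ⁻¹' W ⊆ U) (hW : IsOpen W) (hz : frontier W ⊆ {z}) {o : P1an K}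
    (ho : den o ≠ 0 → ∃ b : K, ∀ c, aff c o = ‖b - c‖) (hoU : o ∉ closure U) : IsOpenBall U := by
  have hoU' : o ∉ U := fun h => hoU (subset_closure h)
  by_cases hinf : ∃ q ∈ U, den q = 0
  -- When infinity lies in `U`, the path from infinity down to the rational point `o` leaves `U` at
  -- a radius `s`, and `U` is shown to be `{|T - b| > s}`, where `b` is the coordinate of `o`.
  · obtain ⟨q, hqU, hq⟩ := hinf
    have ho0 : den o ≠ 0 := fun h => hoU' (eq_of_den_eq_zero h hq ▸ hqU)
    obtain ⟨b, hb⟩ := ho ho0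
    have hbo : aff b o = 0 := by rw [hb, sub_self, norm_zero]
    obtain ⟨r, hr⟩ := eventually_atTop.1 (((tendsto_up ho0 hq).eventually
      (hU.mem_nhds hqU)).and (eventually_ge_atTop 0))
    obtain ⟨s, hs0, hsr, hsU, hs, hscl⟩ :=
      exists_last_exit hU (hr r le_rfl).2 hoU' (hr r le_rfl).1
    have hs' : ∀ t, s < t → up t o ∈ U := fun t ht =>
      (le_total t r).elim (hs t ht) fun h => (hr t h).1
    -- At `s = 0` the exit point would be `o` itself, which is not in the closure of `U`.
    have hspos : 0 < s := by
      refine lt_of_le_of_ne hs0 fun h => hoU ?_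
      rw [← h, up_zero] at hscl
      refine closure_mono ?_ hscl
      rintro _ ⟨t, ht, rfl⟩
      exact hs' t (h ▸ ht.1)
    have hg : IsGaussPoint b s (up s o) := isGaussPoint_up ho0 (hbo.trans_le hs0)
    refine ⟨b, s, hspos, Or.inr (Set.Subset.antisymm (fun x hx => ?_) fun w hw => ?_)⟩
    · rw [mem_coDisc]
      intro hx0
      by_contra hxs
      have hbel : Below x (up s o) := (hg.below_iff hs0).2 ⟨hx0, not_lt.1 hxs⟩
      obtain ⟨a, ρ, -, hg', hxd⟩ := exists_isGaussPoint_of_below hbel hg.1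
        (fun h => hsU (h ▸ hx))
      exact hsU (hg'.mem hUc hx hqU hxd fun h => (mem_disc.1 h).1 hq)
    -- A missing point `w` gives a second end: from the point where the paths from `o` and `w` meet,
    -- the descents to `o` and to `w` both leave `U`.
    · by_contra hwU
      have hw0 : den w ≠ 0 := fun h => hwU (eq_of_den_eq_zero h hq ▸ hqU)
      have hsw := mem_coDisc.1 hw hw0
      set t := aff b w with ht
      have ht0 := aff_nonneg b w
      have hc : up t o = up t w :=
        (isGaussPoint_up ho0 (hbo.trans_le ht0)).eq (isGaussPoint_up hw0 le_rfl)
      obtain ⟨s₂, hs₂0, hs₂t, hs₂U, hs₂, hs₂cl⟩ := exists_last_exit hU ht0 hwU (hc ▸ hs' t hsw)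
      obtain ⟨s₁, hs₁0, hs₁t, hs₁U, hs₁, hs₁cl⟩ := exists_last_exit hU ht0 hoU' (hs' t hsw)
      refine false_of_two_ends hf hinj hmaps hclosed hW hz (c := up t o)
        (isPreconnected_up o (I := Set.Ioc s₁ t) Set.ordConnected_Ioc)
        (isPreconnected_up w (I := Set.Ioc s₂ t) Set.ordConnected_Ioc) ?_ ?_
        ⟨t, Set.right_mem_Ioc.2 hs₁t, rfl⟩ ⟨t, Set.right_mem_Ioc.2 hs₂t, hc.symm⟩ ?_
        hs₁cl hs₂cl hs₁U hs₂U
      · rintro _ ⟨ρ, hρ, rfl⟩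
        exact hs₁ ρ hρ.1 hρ.2
      · rintro _ ⟨ρ, hρ, rfl⟩
        exact hs₂ ρ hρ.1 hρ.2
      · rintro _ ⟨ρ, hρ, rfl⟩ ⟨ρ', hρ', h⟩
        have e := congrArg (aff b) h
        simp only [aff_up hw0, aff_up ho0, hbo, ← ht] at e
        rw [max_eq_left hρ'.2, max_eq_right (hs₁0.trans hρ.1.le)] at e
        rw [e]
  · push Not at hinf
    obtain ⟨x, hx⟩ := hUne
    have hx0 := hinf x hx
    -- On the path upwards from `x`, connectedness of `U` fills in all radii below one that occurs.
    have hint : ∀ r s, s ≤ r → up r x ∈ U → up s x ∈ U := by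
      intro r s hsr hr
      by_contra hs
      obtain ⟨a, ρ, hρ, hg, hxd⟩ := exists_isGaussPoint_of_below (below_up s x)
        (den_up_ne_zero.2 hx0) (fun h => hs (h ▸ hx))
      refine hs (hg.mem hUc hx hr hxd fun h => ?_)
      have h1 := (mem_disc.1 h).2
      have h2 := hg.aff_self hρ.le
      rw [aff_up hx0] at h1 h2
      grind
    -- If the path from `x` leaves `U` upwards at `y`, then a point `w` outside `U` whose path joins
    -- this path inside `U` produces a second end.
    have fill : ∀ {w : P1an K} {t : ℝ} {I : Set ℝ} {y : P1an K}, den w ≠ 0 → w ∉ U → 0 ≤ t →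
        up t w = up t x → I.OrdConnected → t ∈ I → (∀ s ∈ I, t ≤ s) → (∀ s ∈ I, up s x ∈ U) →
        y ∈ closure ((fun s => up s x) '' I) → y ∉ U → False := by
      intro w t I y hw0 hwU ht0 hwx hI htI hIt hIU hycl hyU
      obtain ⟨s, hs0, hst, hsU, hs, hscl⟩ := exists_last_exit hU ht0 hwU (hwx ▸ hIU t htI)
      refine false_of_two_ends hf hinj hmaps hclosed hW hz (c := up t w)
        (isPreconnected_up w (I := Set.Ioc s t) Set.ordConnected_Ioc)
        (isPreconnected_up x hI) ?_ ?_
        ⟨t, Set.right_mem_Ioc.2 hst, rfl⟩ ⟨t, htI, hwx.symm⟩ ?_ hscl hycl hsU hyU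
      · rintro _ ⟨ρ, hρ, rfl⟩
        exact hs ρ hρ.1 hρ.2
      · rintro _ ⟨ρ, hρ, rfl⟩
        exact hIU ρ hρ
      · rintro _ ⟨ρ, hρ, rfl⟩ ⟨ρ', hρ', h⟩
        refine ext_aff (den_up_ne_zero.2 hw0) (den_up_ne_zero.2 hw0) fun b => ?_
        have e := congrArg (aff b) h
        have e' := congrArg (aff b) hwx
        have h1 := hIt ρ' hρ'
        have h2 := hρ.2
        simp only [aff_up hw0, aff_up hx0] at e e' ⊢
        grind
    -- With a finite exit radius `R`, the set `U` is the disc of radius `R` whose Gauss point is the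
    -- exit point. Otherwise infinity is a boundary point of `U`, and the descent to `o` supplies a
    -- forbidden second end.
    by_cases hbdd : BddAbove {r | up r x ∈ U}
    · have hne : {r | up r x ∈ U}.Nonempty := ⟨0, by simpa [up_zero] using hx⟩
      set R := sSup {r | up r x ∈ U} with hR
      have hRU : up R x ∉ U := by
        intro h
        obtain ⟨ε, hε, hball⟩ := Metric.isOpen_iff.1 (hU.preimage (continuous_up x)) R h
        have h1 : R + ε / 2 ∈ {r | up r x ∈ U} := hball (by
          rw [Metric.mem_ball, Real.dist_eq, add_sub_cancel_left, abs_of_pos (by linarith)]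
          linarith)
        have := le_csSup hbdd h1
        linarith
      have hlt : ∀ r, r < R → up r x ∈ U := by
        intro r hr
        obtain ⟨s, hs, hrs⟩ := exists_lt_of_lt_csSup hne hr
        exact hint s r hrs.le hs
      obtain ⟨a, ρ, hρ, hg, hxd⟩ := exists_isGaussPoint_of_below (below_up R x)
        (den_up_ne_zero.2 hx0) (fun h => hRU (h ▸ hx))
      have hρR : ρ = R := by
        have h1 := (mem_disc.1 hxd).2
        have h2 := hg.aff_self hρ.le
        rw [aff_up hx0] at h2
        grind
      rw [hρR] at hρ hg hxd
      refine ⟨a, R, hρ, Or.inl (Set.Subset.antisymm (fun y hy => ?_) fun w hw => ?_)⟩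
      · by_contra hyd
        exact hRU (hg.mem hUc hx hy hxd hyd)
      · by_contra hwU
        have hw' := mem_disc.1 hw
        have hx' := mem_disc.1 hxd
        have htR : max (aff a w) (aff a x) < R := max_lt hw'.2 hx'.2
        refine fill (I := Set.Ico (max (aff a w) (aff a x)) R) hw'.1 hwU
          (le_max_of_le_left (aff_nonneg a w)) ((isGaussPoint_up hw'.1 (le_max_left _ _)).eq
            (isGaussPoint_up hx'.1 (le_max_right _ _))) Set.ordConnected_Ico
          (Set.left_mem_Ico.2 htR) (fun s hs => hs.1) (fun s hs => hlt s hs.2) ?_ hRU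
        refine image_closure_subset_closure_image (continuous_up x) ⟨R, ?_, rfl⟩
        rw [closure_Ico htR.ne]
        exact Set.right_mem_Icc.2 htR.le
    · exfalso
      have hall : ∀ r, up r x ∈ U := by
        intro r
        obtain ⟨s, hs, hrs⟩ := not_bddAbove_iff.1 hbdd r
        exact hint s r hrs.le hs
      obtain ⟨q, hq⟩ := exists_den_eq_zero K
      have hqcl : ∀ r, q ∈ closure ((fun s => up s x) '' Set.Ici r) := mem_closure_up hx0 hq
      have hqU : q ∈ closure U := by
        refine closure_mono ?_ (hqcl 0)
        rintro _ ⟨r, -, rfl⟩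
        exact hall r
      have ho0 : den o ≠ 0 := fun h => hoU (eq_of_den_eq_zero h hq ▸ hqU)
      refine fill (I := Set.Ici (max (aff 0 o) (aff 0 x))) ho0 hoU'
        (le_max_of_le_left (aff_nonneg 0 o)) ((isGaussPoint_up ho0 (le_max_left _ _)).eq
          (isGaussPoint_up hx0 (le_max_right _ _))) Set.ordConnected_Ici Set.self_mem_Ici
        (fun s hs => hs) (fun s _ => hall s) (hqcl _) fun h => hinf q h hq

/-- A disjoint union of open sets mapped homeomorphically onto `W`, where `W` has a single boundary
point, consists of Berkovich open balls. -/
theorem Decomposes.isOpenBall [IsUltrametricDist K] (hf : Continuous f)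
    (h : Decomposes f (fun _ => True) W) (hW : IsOpen W) (hWc : IsConnected W)
    (hz : frontier W ⊆ {z}) {o : P1an K} (ho : den o ≠ 0 → ∃ b : K, ∀ c, aff c o = ‖b - c‖)
    (hfo : f o ∉ closure W) : Decomposes f IsOpenBall W := by
  obtain ⟨𝒰, h𝒰, hdisj, hcover⟩ := h
  refine ⟨𝒰, fun U hU => ⟨(h𝒰 U hU).1, ?_, (h𝒰 U hU).2.2⟩, hdisj, hcover⟩
  obtain ⟨hUo, -, e, he⟩ := h𝒰 U hU
  have hmaps : Set.MapsTo f U W := fun u hu => he ⟨u, hu⟩ ▸ (e ⟨u, hu⟩).2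
  have hUW : U = Set.range fun w : W => (e.symm w : P1an K) := by
    ext u
    refine ⟨fun hu => ⟨e ⟨u, hu⟩, by simp⟩, ?_⟩
    rintro ⟨w, rfl⟩
    exact (e.symm w).2
  have : ConnectedSpace W := Subtype.connectedSpace hWc
  have hUc : IsConnected U := by
    rw [hUW]
    exact isConnected_range (continuous_subtype_val.comp e.symm.continuous)
  refine isOpenBall_of_injOn hf hUo hUc.nonempty hUc.isPreconnected ?_ hmaps ?_ hW hz ho
    fun hoU => hfo (map_mem_closure hf hoU hmaps)
  · intro u hu u' hu' huu
    have : e ⟨u, hu⟩ = e ⟨u', hu'⟩ := Subtype.ext (by rw [he, he]; exact huu)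
    exact congrArg Subtype.val (e.injective this)
  -- A piece is relatively closed in the preimage of `W`, because the other pieces are open and
  -- disjoint from it.
  · rintro y ⟨hy, hyW⟩
    rw [← hcover] at hyW
    obtain ⟨V, hV, hyV⟩ := hyW
    obtain ⟨x, hxV, hxU⟩ := mem_closure_iff.1 hy V (h𝒰 V hV).1 hyV
    have hVU : V = U := by
      by_contra hne
      exact Set.disjoint_left.1 (hdisj hV hU hne) hxV hxU
    exact hVU ▸ hyV

end OpenBalls

/-! ### Restricting a decomposition and forgetting the shape of its pieces -/

section General

theorem Decomposes.mono {X Y : Type*} [TopologicalSpace X] [TopologicalSpace Y] {f : X → Y}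
    (hf : Continuous f) {W W' : Set Y} (h : Decomposes f (fun _ => True) W) (hW' : IsOpen W')
    (hsub : W' ⊆ W) : Decomposes f (fun _ => True) W' := by
  obtain ⟨𝒰, h𝒰, hdisj, hcover⟩ := h
  refine ⟨(fun U => U ∩ f ⁻¹' W') '' 𝒰, ?_, ?_, ?_⟩
  · rintro _ ⟨U, hU, rfl⟩
    obtain ⟨hUo, -, e, he⟩ := h𝒰 U hU
    refine ⟨hUo.inter (hW'.preimage hf), trivial, ?_⟩
    refine ⟨⟨⟨fun u => ⟨f u.1, u.2.2⟩, fun w => ⟨e.symm ⟨w, hsub w.2⟩, (e.symm _).2, ?_⟩, ?_, ?_⟩,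
      ?_, ?_⟩, fun u => rfl⟩
    · rw [Set.mem_preimage, ← he, e.apply_symm_apply]
      exact w.2
    · intro u
      apply Subtype.ext
      have : (⟨f u.1, hsub u.2.2⟩ : W) = e ⟨u.1, u.2.1⟩ := Subtype.ext (he ⟨u.1, u.2.1⟩).symm
      simp only [this, e.symm_apply_apply]
    · intro w
      apply Subtype.ext
      simp only [← he, e.apply_symm_apply]
    · exact Continuous.subtype_mk (hf.comp continuous_subtype_val) _
    · refine Continuous.subtype_mk (continuous_subtype_val.comp (e.symm.continuous.comp ?_)) _
      exact Continuous.subtype_mk continuous_subtype_val _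
  · rintro _ ⟨U, hU, rfl⟩ _ ⟨V, hV, rfl⟩ hne
    have hUV : U ≠ V := fun h => hne (by rw [h])
    exact (hdisj hU hV hUV).mono Set.inter_subset_left Set.inter_subset_left
  · rw [Set.sUnion_image, ← Set.iUnion₂_inter, ← Set.sUnion_eq_biUnion, hcover,
      ← Set.preimage_inter, Set.inter_eq_right.2 hsub]

theorem Decomposes.weaken {X Y : Type*} [TopologicalSpace X] [TopologicalSpace Y] {f : X → Y}
    {P : Set X → Prop} {W : Set Y} (h : Decomposes f P W) : Decomposes f (fun _ => True) W := by
  obtain ⟨𝒰, h𝒰, hdisj, hcover⟩ := h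
  exact ⟨𝒰, fun U hU => ⟨(h𝒰 U hU).1, trivial, (h𝒰 U hU).2.2⟩, hdisj, hcover⟩

end General

/-! ### Balls around a point with given homogeneous coordinates -/

section BallAround

variable {L : Type u} [NormedField L]

theorem ballAround_of_eq_zero {v : Fin 2 → L} (hv : v 1 = 0) {r : ℝ} (hr : 0 < r) :
    ballAround v r = coDisc 0 r⁻¹ := by
  rw [ballAround, if_pos hv]
  ext p
  change den p < r * absForm 1 (X 0) p ↔ r⁻¹ * den p < lin 0 p
  rw [absForm_X_zero, inv_mul_lt_iff₀ hr]

theorem isOpen_ballAround (v : Fin 2 → L) {r : ℝ} (hr : 0 < r) : IsOpen (ballAround v r) := by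
  by_cases hv : v 1 = 0
  · rw [ballAround_of_eq_zero hv hr]
    exact isOpen_coDisc _ _
  · rw [ballAround, if_neg hv]
    exact isOpen_disc _ _

end BallAround

/-! ### The analytification of a finite endomorphism -/

section Endo

variable {k : Type u} [NormedField k] [IsAlgClosed k] (φ : FiniteEndo k)
  (L : Type u) [NormedField L] [NormedAlgebra k L]

theorem FiniteEndo.continuous_an : Continuous (φ.an L) := by
  have h : Continuous (φ.anCone L) :=
    continuous_induced_rng.2 (continuous_pi fun F => continuous_cone_eval (φ.subst L F))
  exact h.quotient_map' _

variable {L} [IsAlgClosed L]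

theorem exists_isotropic_vector {d : ℕ} (hd : 0 < d) {F : HPoly L} (hF : F.IsHomogeneous d) :
    ∃ v : Fin 2 → L, v ≠ 0 ∧ eval v F = 0 := by
  obtain ⟨c, n, s, hns, rfl⟩ := exists_linear_factors hF
  rcases Nat.eq_zero_or_pos n with rfl | hn
  · obtain ⟨a, ha⟩ := Multiset.card_pos_iff_exists_mem.1 (by omega : 0 < s.card)
    refine ⟨![a, 1], fun h => one_ne_zero (congrFun h 1), ?_⟩
    obtain ⟨t, rfl⟩ := Multiset.exists_cons_of_mem ha
    simp
  · refine ⟨![1, 0], fun h => one_ne_zero (congrFun h 0), ?_⟩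
    simp [hn.ne']

variable [IsUltrametricDist L]

/-- A zero of the form `F i` is a rational point sent to infinity (`i = 1`) or to `0` (`i = 0`). It
serves as the rational point outside the closure of every piece over a disc, respectively over a
neighbourhood `{|T| > r}` of infinity. -/
theorem FiniteEndo.exists_an_eval_eq_zero (i : Fin 2) : ∃ o : P1an L,
    (den o ≠ 0 → ∃ b : L, ∀ c, aff c o = ‖b - c‖) ∧ absForm 1 (X i) (φ.an L o) = 0 := by
  obtain ⟨v, hv, hvF⟩ := exists_isotropic_vector φ.deg_pos
    ((φ.homogeneous i).map (algebraMap k L))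
  refine ⟨pointBelow L L v hv, fun h => ?_, ?_⟩
  · exact ⟨v 0 / v 1, fun c => aff_pointBelow hv ((den_pointBelow_ne_zero hv).1 h) c⟩
  · refine (absForm_mk (isHomogeneous_X L i) (φ.anCone L (evalCone L L v hv))).trans ?_
    have : (φ.anCone L (evalCone L L v hv)).1 (X i) = 0 := by
      change ‖aeval v (aeval (fun i => map (algebraMap k L) (φ.F i)) (X i : HPoly L))‖ = 0
      rw [aeval_X, aeval_eq_eval, hvF, norm_zero]
    rw [this, zero_div]

theorem FiniteEndo.splitsIntoBalls_disc {a : L} {r : ℝ} (hr : 0 < r)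
    (h : φ.Splits L (disc a r)) : φ.SplitsIntoBalls L (disc a r) := by
  obtain ⟨o, ho, hfo⟩ := φ.exists_an_eval_eq_zero (L := L) 1
  obtain ⟨p, hp, hpa⟩ := exists_aff_eq_norm a
  have hpd : p ∈ disc a r := mem_disc.2 ⟨hp, by rwa [hpa, sub_self, norm_zero]⟩
  refine Decomposes.isOpenBall (φ.continuous_an L) h (isOpen_disc a r)
    ⟨⟨p, hpd⟩, isPreconnected_disc a r⟩ (z := up r p) (fun z hz => ?_) ho fun hcl => ?_
  · refine (isGaussPoint_of_mem_frontier_disc hz).eq (isGaussPoint_up hp ?_)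
    rw [hpa, sub_self, norm_zero]
    exact hr.le
  · have h1 : lin a (φ.an L o) ≤ r * den (φ.an L o) := closure_disc_subset a r hcl
    have h2 : den (φ.an L o) = 0 := hfo
    rw [h2, lin_eq_one_of_den_eq_zero h2, mul_zero] at h1
    exact absurd h1 (not_le.2 one_pos)

theorem FiniteEndo.splitsIntoBalls_coDisc_zero {r : ℝ} (hr : 0 < r)
    (h : φ.Splits L (coDisc 0 r)) : φ.SplitsIntoBalls L (coDisc 0 r) := by
  obtain ⟨o, ho, hfo⟩ := φ.exists_an_eval_eq_zero (L := L) 0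
  obtain ⟨q, hq⟩ := exists_den_eq_zero L
  obtain ⟨p, hp, hpa⟩ := exists_aff_eq_norm (0 : L)
  refine Decomposes.isOpenBall (φ.continuous_an L) h (isOpen_coDisc 0 r)
    ⟨⟨q, mem_coDisc.2 fun h => (h hq).elim⟩, isPreconnected_coDisc 0 r⟩ (z := up r p)
    (fun z hz => ?_) ho fun hcl => ?_
  · refine (isGaussPoint_of_mem_frontier_coDisc hz).eq (isGaussPoint_up hp ?_)
    rw [hpa, sub_self, norm_zero]
    exact hr.le
  · have h1 : r * den (φ.an L o) ≤ lin 0 (φ.an L o) := closure_coDisc_subset 0 r hcl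
    rw [absForm_X_zero] at hfo
    have h2 := max_lin_den (φ.an L o)
    rw [hfo] at h1 h2
    rw [max_eq_right (den_nonneg _)] at h2
    rw [h2, mul_one] at h1
    exact absurd h1 (not_le.2 hr)

theorem FiniteEndo.splitsIntoBalls_ballAround {v : Fin 2 → L} {r : ℝ} (hr : 0 < r)
    (h : φ.Splits L (ballAround v r)) : φ.SplitsIntoBalls L (ballAround v r) := by
  by_cases hv : v 1 = 0
  · rw [ballAround_of_eq_zero hv hr] at h ⊢
    exact φ.splitsIntoBalls_coDisc_zero (inv_pos.2 hr) h
  · rw [ballAround, if_neg hv] at h ⊢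
    exact φ.splitsIntoBalls_disc hr h

end Endo

/-! ### The smallest radius as a size function -/

section SizeFunction

theorem definable_le : (∅ : Set Rpos).Definable orderedGroup {w : Fin 2 → Rpos | w 0 ≤ w 1} := by
  rw [Set.empty_definable_iff]
  let R : orderedGroup.Relations 2 := GroupRel.le
  refine ⟨R.formula ![FirstOrder.Language.Term.var 0, FirstOrder.Language.Term.var 1], ?_⟩
  ext w
  change w 0 ≤ w 1 ↔ (R.formula _).Realize w
  rw [FirstOrder.Language.Formula.realize_rel]
  rfl

/-- The minimum is a case distinction along the definable condition `f ≤ g`. -/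
theorem definableFun_min {α : Type*} {f g : (α → Rpos) → Rpos}
    (hf : (∅ : Set Rpos).DefinableFun orderedGroup f)
    (hg : (∅ : Set Rpos).DefinableFun orderedGroup g) :
    (∅ : Set Rpos).DefinableFun orderedGroup fun v => min (f v) (g v) := by
  have hF : (∅ : Set Rpos).DefinableMap orderedGroup fun v => ![f v, g v] := by
    intro i
    fin_cases i
    · exact hf
    · exact hg
  have hle : (∅ : Set Rpos).Definable orderedGroup {v | f v ≤ g v} := definable_le.preimage_map hF
  classical
  simp only [min_def]
  exact Set.DefinableFun.ite hle hf hg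

/-- The smallest entry of a tuple of radii. -/
def minRadius (ρ : Fin 2 × Fin 2 → Rpos) : Rpos :=
  min (min (ρ (0, 0)) (ρ (0, 1))) (min (ρ (1, 0)) (ρ (1, 1)))

theorem isSizeFunction_minRadius : IsSizeFunction minRadius where
  continuous := by
    unfold minRadius
    fun_prop
  monotone ρ ρ' h := min_le_min (min_le_min (h _) (h _)) (min_le_min (h _) (h _))
  definable := definableFun_min (definableFun_min (.proj _) (.proj _))
    (definableFun_min (.proj _) (.proj _))

theorem minRadius_le (ρ : Fin 2 × Fin 2 → Rpos) (t j : Fin 2) : minRadius ρ ≤ ρ (t, j) := by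
  unfold minRadius
  fin_cases t <;> fin_cases j <;> simp

end SizeFunction

/-! ### Comparison of the two families of balls -/

section Comparison

variable {L : Type u} [NormedField L]

/-- The ratio between the radii of a small ball around `[v 0 : v 1]` in the coordinate `T` and in
the charts containing the point. -/
def radiusRatio (v : Fin 2 → L) : ℝ :=
  open Classical in if v 1 = 0 then 1 else (max ‖v 0‖ ‖v 1‖ / ‖v 1‖) ^ 2

theorem one_le_radiusRatio (v : Fin 2 → L) : 1 ≤ radiusRatio v := by
  unfold radiusRatio
  split_ifs with h
  · exact le_rfl
  · exact one_le_pow₀ ((one_le_div (norm_pos_iff.2 h)).2 (le_max_right _ _))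

theorem radiusRatio_pos (v : Fin 2 → L) : 0 < radiusRatio v :=
  one_pos.trans_le (one_le_radiusRatio v)

theorem absForm_swap {c : L} (hc : c ≠ 0) (p : P1an L) :
    absForm 1 (X 1 - C c * X 0) p = ‖c‖ * lin c⁻¹ p := by
  have h : (X 1 - C c * X 0 : HPoly L).IsHomogeneous 1 := by
    refine (isHomogeneous_X L 1).sub ?_
    simpa using (isHomogeneous_C (Fin 2) c).mul (isHomogeneous_X L 0)
  have e : (X 1 - C c * X 0 : HPoly L) = C (-c) * (X 0 - C c⁻¹ * X 1) := by
    have : C c * C c⁻¹ = (1 : HPoly L) := by rw [← C_mul, mul_inv_cancel₀ hc, C_1]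
    rw [C_neg]
    linear_combination (-X 1 : HPoly L) * this
  rw [← mk_toCone p, absForm_mk h, lin_mk, e, map_mul, (toCone p).2.2.1, norm_neg, pow_one,
    mul_div_assoc]

theorem chartBall_mono {v : Fin 2 → L} {t : Fin 2} {ρ ρ' : Fin 2 → ℝ}
    (h : ∀ j, j ≠ t → ρ j ≤ ρ' j) : chartBall v t ρ ⊆ chartBall v t ρ' := by
  rintro p ⟨h1, h2⟩
  refine ⟨h1, fun j hj => (h2 j hj).trans_le ?_⟩
  have h3 : 0 ≤ absForm 1 (X t) p := by
    fin_cases t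
    · exact (absForm_X_zero p).symm ▸ lin_nonneg 0 p
    · exact den_nonneg p
  exact mul_le_mul_of_nonneg_right (h j hj) h3

theorem mem_chartBall_zero {v : Fin 2 → L} {ρ : Fin 2 → ℝ} {p : P1an L} :
    p ∈ chartBall v 0 ρ ↔ den p ≤ lin 0 p ∧
      absForm 1 (X 1 - C (v 1 / v 0) * X 0) p < ρ 1 * lin 0 p := by
  simp only [chartBall, chart, Set.mem_ofPred_eq, Fin.forall_fin_two, absForm_X_zero, den]
  simp

theorem mem_chartBall_one {v : Fin 2 → L} {ρ : Fin 2 → ℝ} {p : P1an L} :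
    p ∈ chartBall v 1 ρ ↔ lin 0 p ≤ den p ∧ lin (v 0 / v 1) p < ρ 0 * den p := by
  simp only [chartBall, chart, Set.mem_ofPred_eq, Fin.forall_fin_two, absForm_X_zero, den]
  simp [lin]

/-- Write `a = v 0 / v 1`. In the chart at infinity with `|a| ≥ 1` one has `|1/T - 1/a| = |T - a| /
(|T||a|)`, and `|T| = |a|` on the ball, whence the factor `|a|^2`; in the other chart, and at the
point infinity itself, the factor is `1`. The bound `r ≤ 1` makes the chart condition automatic on
the ball. For `|a| = 1` both charts apply and give the same radius. -/
theorem chartBall_eq_ballAround {v : Fin 2 → L} (hv : v ≠ 0) {t : Fin 2} (ht : InChart v t) {r : ℝ}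
    (hr : 0 < r) (hr1 : r ≤ 1) {ρ : Fin 2 → ℝ} (hρ : ∀ j, j ≠ t → ρ j = r / radiusRatio v) :
    chartBall v t ρ = ballAround v r := by
  have hmax := max_norm_pos hv
  by_cases h1 : v 1 = 0
  · have h0 : 0 < ‖v 0‖ := by simpa [h1] using hmax
    have ht0 : t = 0 := by
      fin_cases t
      · rfl
      · have := ht 0
        simp only [Fin.mk_one, h1, norm_zero] at this
        exact (h0.not_ge this).elim
    subst ht0
    ext p
    rw [mem_chartBall_zero, hρ 1 one_ne_zero, radiusRatio, if_pos h1, ballAround, if_pos h1, h1,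
      zero_div, map_zero, zero_mul, sub_zero, div_one, Set.mem_ofPred_eq, absForm_X_zero]
    change _ ∧ den p < _ ↔ den p < _
    refine and_iff_right_of_imp fun h => h.le.trans ?_
    exact mul_le_of_le_one_left (lin_nonneg 0 p) hr1
  rw [ballAround, if_neg h1]
  have h1' : 0 < ‖v 1‖ := norm_pos_iff.2 h1
  set a := v 0 / v 1 with ha
  have hna : ‖a‖ = ‖v 0‖ / ‖v 1‖ := norm_div _ _
  have hcoord : ∀ {p : P1an L}, p ∈ disc a r → aff 0 p ≤ max ‖a‖ r ∧ ‖a‖ ≤ max r (aff 0 p) := by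
    intro p hp
    obtain ⟨hp0, hp⟩ := mem_disc.1 hp
    have e1 := aff_le hp0 a 0
    have e2 := norm_sub_le_aff hp0 a 0
    rw [sub_zero] at e1 e2
    grind
  fin_cases t
  · have h01 : ‖v 1‖ ≤ ‖v 0‖ := ht 1
    have ha1 : 1 ≤ ‖a‖ := by rwa [hna, one_le_div h1']
    have ha0 : 0 < ‖a‖ := one_pos.trans_le ha1
    have hratio : radiusRatio v = ‖a‖ ^ 2 := by
      rw [radiusRatio, if_neg h1, max_eq_left h01, hna]
    have hinv : v 1 / v 0 = a⁻¹ := by rw [ha, inv_div]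
    ext p
    refine mem_chartBall_zero.trans ?_
    rw [hinv, absForm_swap (inv_ne_zero (norm_pos_iff.1 ha0)), inv_inv, norm_inv,
      hρ 1 one_ne_zero, hratio]
    have hiff : ‖a‖⁻¹ * lin a p < r / ‖a‖ ^ 2 * lin 0 p ↔ lin a p < r / ‖a‖ * lin 0 p := by
      rw [inv_mul_lt_iff₀ ha0]
      have : ‖a‖ * (r / ‖a‖ ^ 2 * lin 0 p) = r / ‖a‖ * lin 0 p := by
        field_simp
      rw [this]
    rw [hiff]
    have hra : r / ‖a‖ ≤ 1 := (div_le_one ha0).2 (hr1.trans ha1)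
    constructor
    · rintro ⟨-, h3⟩
      have hp0 : den p ≠ 0 := by
        intro h
        rw [lin_eq_one_of_den_eq_zero h, lin_eq_one_of_den_eq_zero h, mul_one] at h3
        exact absurd h3 (not_lt.2 hra)
      have hp' := den_pos_iff.2 hp0
      have h4 : aff a p < r / ‖a‖ * aff 0 p := by
        rw [aff, aff, ← mul_div_assoc]
        exact div_lt_div_of_pos_right h3 hp'
      have e1 := aff_le hp0 a 0
      rw [sub_zero] at e1
      -- If `|T| > |a|`, then `|T - a|` would be at least `|T|`, which the inequality `h4` with
      -- factor at most `1` excludes.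
      have h5 : aff 0 p ≤ ‖a‖ := by
        by_contra hcon
        have : aff 0 p ≤ aff a p := by grind
        have := mul_le_mul_of_nonneg_right hra (aff_nonneg 0 p)
        linarith
      refine mem_disc.2 ⟨hp0, h4.trans_le ?_⟩
      calc r / ‖a‖ * aff 0 p ≤ r / ‖a‖ * ‖a‖ := by gcongr
        _ = r := div_mul_cancel₀ _ ha0.ne'
    · intro hp
      obtain ⟨e1, e2⟩ := hcoord hp
      obtain ⟨hp0, h4⟩ := mem_disc.1 hp
      have hp' := den_pos_iff.2 hp0
      have e3 : aff 0 p = ‖a‖ ∨ (aff 0 p ≤ 1 ∧ ‖a‖ = 1) := by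
        rcases le_or_gt ‖a‖ (aff 0 p) with h | h
        · exact Or.inl (le_antisymm (e1.trans (max_le le_rfl (hr1.trans ha1))) h)
        · have : ‖a‖ ≤ r := by grind
          exact Or.inr ⟨by linarith, by linarith⟩
      -- In the borderline case `|a| = 1` the strict inequality `|T - a| < r ≤ 1` still forces `|T|
      -- = |a|`.
      have e4 : aff 0 p = ‖a‖ := by
        rcases e3 with h | ⟨h, h'⟩
        · exact h
        · have e5 := norm_sub_le_aff hp0 a 0
          rw [sub_zero] at e5
          grind
      rw [lin_eq_aff hp0 a, lin_eq_aff hp0 0, e4, ← mul_assoc, div_mul_cancel₀ _ ha0.ne']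
      exact ⟨le_mul_of_one_le_left hp'.le ha1, mul_lt_mul_of_pos_right h4 hp'⟩
  · have h01 : ‖v 0‖ ≤ ‖v 1‖ := ht 0
    have ha1 : ‖a‖ ≤ 1 := by rwa [hna, div_le_one h1']
    have hratio : radiusRatio v = 1 := by
      rw [radiusRatio, if_neg h1, max_eq_right h01, div_self h1'.ne', one_pow]
    ext p
    refine mem_chartBall_one.trans ?_
    rw [hρ 0 (by simp), hratio, div_one]
    change _ ∧ p ∈ disc a r ↔ _
    refine and_iff_right_of_imp fun hp => ?_
    have e1 := (hcoord hp).1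
    have hp0 := (mem_disc.1 hp).1
    have hp' := den_pos_iff.2 hp0
    exact (div_le_one hp').1 (e1.trans (max_le ha1 hr1))

theorem exists_inChart (v : Fin 2 → L) : ∃ t, InChart v t := by
  rcases le_total ‖v 0‖ ‖v 1‖ with h | h
  · exact ⟨1, fun j => by fin_cases j; exacts [h, le_rfl]⟩
  · exact ⟨0, fun j => by fin_cases j; exacts [le_rfl, h]⟩

theorem ballAround_subset {v : Fin 2 → L} (hv : v ≠ 0) {W : Set (P1an L)}
    {ρ : Fin 2 × Fin 2 → Rpos} (h : HasPolyradius v W ρ) :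
    ballAround v (min 1 (minRadius ρ * radiusRatio v)) ⊆ W := by
  obtain ⟨t, ht⟩ := exists_inChart v
  obtain ⟨-, -, rfl⟩ := (h t).1 ht
  have hpos := radiusRatio_pos v
  rw [← chartBall_eq_ballAround hv ht (lt_min one_pos (mul_pos (minRadius ρ).2 hpos))
    (min_le_left _ _) (ρ := fun _ => min 1 (minRadius ρ * radiusRatio v) / radiusRatio v)
    fun _ _ => rfl]
  refine chartBall_mono fun j _ => ?_
  rw [div_le_iff₀ hpos]
  exact (min_le_right _ _).trans (mul_le_mul_of_nonneg_right (minRadius_le ρ t j) hpos.le)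

/-- The entry `r / radiusRatio v` is placed in each chart containing the point and `1` elsewhere.
Being at most `1`, it is the minimum of the tuple, so no padding entry interferes. -/
theorem exists_hasPolyradius {v : Fin 2 → L} (hv : v ≠ 0) {r : ℝ} (hr : 0 < r) (hr1 : r ≤ 1) :
    ∃ ρ, HasPolyradius v (ballAround v r) ρ ∧ (minRadius ρ : ℝ) * radiusRatio v = r := by
  classical
  have hpos := radiusRatio_pos v
  have hle : r / radiusRatio v ≤ 1 := (div_le_one hpos).2 (hr1.trans (one_le_radiusRatio v))
  set s : Rpos := ⟨r / radiusRatio v, div_pos hr hpos⟩ with hs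
  have hs1 : s ≤ 1 := hle
  set ρ : Fin 2 × Fin 2 → Rpos := fun i => if InChart v i.1 ∧ i.2 ≠ i.1 then s else 1 with hρ
  have hsρ : ∀ i, s ≤ ρ i := by
    intro i
    simp only [hρ]
    split_ifs
    exacts [le_rfl, hs1]
  have hρ1 : ∀ i, ρ i ≤ 1 := by
    intro i
    simp only [hρ]
    split_ifs
    exacts [hs1, le_rfl]
  refine ⟨ρ, fun t => ⟨fun ht => ⟨?_, fun j => hρ1 (t, j), ?_⟩, fun ht j => ?_⟩, ?_⟩
  · simp [hρ]
  · refine (chartBall_eq_ballAround hv ht hr hr1 fun j hj => ?_).symm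
    simp only [hρ]
    rw [if_pos ⟨ht, hj⟩]
  · simp [hρ, ht]
  · have : minRadius ρ = s := by
      refine le_antisymm ?_ (le_min (le_min (hsρ _) (hsρ _)) (le_min (hsρ _) (hsρ _)))
      obtain ⟨t, ht⟩ := exists_inChart v
      obtain ⟨j, hj⟩ : ∃ j, j ≠ t := exists_ne t
      refine (minRadius_le ρ t j).trans ?_
      simp only [hρ]
      rw [if_pos ⟨ht, hj⟩]
    rw [this]
    exact div_mul_cancel₀ _ hpos.ne'

end Comparison

/-- The factor by which radii around a point in the coordinate `T` exceed radii in the charts. -/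
def scale {K : Type u} [NormedField K] (p : P1an K) : ℝ :=
  open Classical in if den p = 0 then 1 else (1 / den p) ^ 2

theorem scale_pos {K : Type u} [NormedField K] (p : P1an K) : 0 < scale p := by
  unfold scale
  split_ifs with h
  · exact one_pos
  · exact pow_pos (one_div_pos.2 (den_pos_iff.2 h)) 2

theorem scale_pointBelow {k L : Type u} [NormedField k] [NormedField L] [IsUltrametricDist L]
    [NormedAlgebra k L] (v : Fin 2 → L) (hv : v ≠ 0) :
    scale (pointBelow k L v hv) = radiusRatio v := by
  unfold scale radiusRatio
  by_cases h : v 1 = 0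
  · rw [if_pos h, if_pos (not_not.1 fun h' => (den_pointBelow_ne_zero hv).1 h' h)]
  · rw [if_neg h, if_neg ((den_pointBelow_ne_zero hv).2 h), den_pointBelow, one_div_div]

/-! ### Retraction onto the upward closure of finitely many points -/

section Retraction

variable {K : Type u} [NormedField K]

/-- The normalized radius of the smallest disc containing `p` and `x`. -/
def join (p x : P1an K) : ℝ := ⨅ b : K, max (lin b x) (aff b p * den x)

theorem join_le (p x : P1an K) (b : K) : join p x ≤ max (lin b x) (aff b p * den x) :=
  ciInf_le ⟨0, by rintro _ ⟨a, rfl⟩; exact le_max_of_le_left (lin_nonneg a x)⟩ b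

/-- The error of using a single `b` in the infimum is bounded by `aff b p - radius p`, independently
of `x`. Thus `join p` is a uniform limit of continuous functions. -/
theorem max_lin_le_join {p : P1an K} (hp : den p ≠ 0) (x : P1an K) (b : K) :
    max (lin b x) (aff b p * den x) ≤ join p x + (aff b p - radius p) := by
  have hb := radius_le p b
  rw [← sub_le_iff_le_add]
  refine le_ciInf fun c => ?_
  have hd := den_nonneg x
  have hd1 := den_le_one x
  have h0 := aff_nonneg c p
  have hc := radius_le p c
  have h1 := lin_le c b x
  have h2 : ‖c - b‖ * den x ≤ max (aff c p * den x) (aff b p * den x) := by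
    rw [← max_mul_of_nonneg _ _ hd]
    exact mul_le_mul_of_nonneg_right (norm_sub_le_aff hp c b) hd
  -- Here `den x ≤ 1` makes the error term independent of `x`.
  have h3 : aff b p * den x - (aff b p - radius p) ≤ aff c p * den x := by nlinarith
  have h4 := le_max_left (lin c x) (aff c p * den x)
  have h5 := le_max_right (lin c x) (aff c p * den x)
  rw [sub_le_iff_le_add]
  refine max_le (h1.trans (max_le ?_ (h2.trans (max_le ?_ ?_)))) ?_ <;> linarith

theorem continuous_join {p : P1an K} (hp : den p ≠ 0) : Continuous (join p) := by
  refine continuous_of_uniform_approx_of_continuous fun u hu => ?_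
  obtain ⟨ε, hε, hεu⟩ := Metric.mem_uniformity_dist.1 hu
  obtain ⟨b, hb⟩ := exists_aff_lt (lt_add_of_pos_right (radius p) hε)
  refine ⟨fun x => max (lin b x) (aff b p * den x),
    (continuous_lin b).max (continuous_const.mul continuous_den), fun x => hεu ?_⟩
  have h1 := join_le p x b
  have h2 := max_lin_le_join hp x b
  rw [Real.dist_eq, abs_lt]
  constructor <;> linarith

/-- The point obtained from `x` by increasing its normalized radius to `s`. -/
def lift (s : ℝ) (x : P1an K) : P1an K := up (s / den x) x

/-- A normalized radius at most `1` is a radius at most `max(1,|T|)`, so raising to it does not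
change `max(1,|T|)`. This is the reason for normalizing: the retraction built from `lift` leaves
`scale` unchanged. -/
theorem den_lift {s : ℝ} (hs : s ≤ 1) (x : P1an K) : den (lift s x) = den x := by
  rw [lift, den_up']
  by_cases hx : den x = 0
  · simp [hx]
  · rw [div_mul_cancel₀ _ hx, max_eq_left hs, div_one]

theorem lin_lift {s : ℝ} (hs : s ≤ 1) (a : K) (x : P1an K) :
    lin a (lift s x) = max (lin a x) s := by
  rw [lift, lin_up']
  by_cases hx : den x = 0
  · simp [hx, lin_eq_one_of_den_eq_zero hx, hs]
  · rw [div_mul_cancel₀ _ hx, max_eq_left hs, div_one]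

theorem join_lift {s : ℝ} (hs : s ≤ 1) (p x : P1an K) : join p (lift s x) = max s (join p x) := by
  unfold join
  simp only [den_lift hs, lin_lift hs]
  refine le_antisymm ?_ (max_le ?_ ?_)
  · refine le_of_forall_gt_imp_ge_of_dense fun t ht => ?_
    obtain ⟨b, hb⟩ := exists_lt_of_ciInf_lt ((le_max_right _ _).trans_lt ht)
    refine (ciInf_le ⟨0, ?_⟩ b).trans ?_
    · rintro _ ⟨a, rfl⟩
      exact le_max_of_le_left (le_max_of_le_left (lin_nonneg a x))
    · have := (le_max_left _ _).trans_lt ht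
      grind
  · exact le_ciInf fun b => le_max_of_le_left (le_max_right _ _)
  · exact le_ciInf fun b => (join_le p x b).trans (max_le_max_right _ (le_max_left _ _))

/-- The normalized radius at which the path upwards from `x` meets the upward closure of `P`. -/
def joinInf (P : Finset (P1an K)) (hP : P.Nonempty) (x : P1an K) : ℝ :=
  P.inf' hP fun p => join p x

theorem joinInf_le {P : Finset (P1an K)} (hP : P.Nonempty) (x : P1an K) {p : P1an K} (hp : p ∈ P) :
    joinInf P hP x ≤ join p x :=
  Finset.inf'_le (fun p => join p x) hp

theorem exists_joinInf_eq {P : Finset (P1an K)} (hP : P.Nonempty) (x : P1an K) :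
    ∃ p ∈ P, joinInf P hP x = join p x :=
  Finset.exists_mem_eq_inf' hP _

theorem joinInf_lift {P : Finset (P1an K)} (hP : P.Nonempty) {s : ℝ} (hs : s ≤ 1) (x : P1an K) :
    joinInf P hP (lift s x) = max s (joinInf P hP x) := by
  refine le_antisymm ?_ ?_
  · obtain ⟨p, hp, h⟩ := exists_joinInf_eq hP x
    rw [h, ← join_lift hs]
    exact joinInf_le hP _ hp
  · obtain ⟨p, hp, h⟩ := exists_joinInf_eq hP (lift s x)
    rw [h, join_lift hs]
    exact max_le_max_left _ (joinInf_le hP x hp)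

/-- Having a point over `T = 0` in `P` ensures that paths meet the tree no later than at normalized
radius `|T₁| ≤ 1`. -/
theorem joinInf_le_lin_zero {P : Finset (P1an K)} (hP : P.Nonempty) (h0 : ∃ o ∈ P, aff 0 o = 0)
    (x : P1an K) : joinInf P hP x ≤ lin 0 x := by
  obtain ⟨o, ho, hao⟩ := h0
  refine (joinInf_le hP x ho).trans ((join_le o x 0).trans ?_)
  rw [hao, zero_mul, max_eq_left (lin_nonneg 0 x)]

theorem joinInf_le_one {P : Finset (P1an K)} (hP : P.Nonempty) (h0 : ∃ o ∈ P, aff 0 o = 0)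
    (x : P1an K) : joinInf P hP x ≤ 1 :=
  (joinInf_le_lin_zero hP h0 x).trans (lin_zero_le_one x)

variable [IsAlgClosed K]

theorem lift_eq_self {s : ℝ} (hs : s ≤ 1) {x : P1an K} (h : ∀ a, s ≤ lin a x) : lift s x = x :=
  ext_coords (den_lift hs x) fun a => by rw [lin_lift hs, max_eq_left (h a)]

theorem join_le_lin_of_below {p x : P1an K} (hp : den p ≠ 0) (h : Below p x) (b : K) :
    join p x ≤ lin b x := by
  refine (join_le p x b).trans (max_le le_rfl ?_)
  rw [aff, div_mul_eq_mul_div, div_le_iff₀ (den_pos_iff.2 hp)]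
  exact below_iff.1 h b

theorem below_lift {p x : P1an K} (hp : den p ≠ 0) {s : ℝ} (hs : s ≤ 1) (h : join p x ≤ s) :
    Below p (lift s x) := by
  rw [below_iff]
  intro a
  rw [den_lift hs, lin_lift hs, lin_eq_aff hp, mul_right_comm]
  refine mul_le_mul_of_nonneg_right ?_ (den_nonneg p)
  refine le_of_forall_gt_imp_ge_of_dense fun t ht => ?_
  obtain ⟨b, hb⟩ := exists_lt_of_ciInf_lt (h.trans_lt ((le_max_right _ _).trans_lt ht))
  have h1 := mul_le_mul_of_nonneg_right (aff_le hp b a) (den_nonneg x)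
  rw [max_mul_of_nonneg _ _ (den_nonneg x)] at h1
  have h2 : ‖b - a‖ * den x ≤ max (lin b x) (lin a x) := by
    by_cases hx : den x = 0
    · rw [hx, mul_zero]
      exact le_max_of_le_left (lin_nonneg _ _)
    · have := mul_le_mul_of_nonneg_right (norm_sub_le_aff hx b a) (den_nonneg x)
      rwa [max_mul_of_nonneg _ _ (den_nonneg x), ← lin_eq_aff hx, ← lin_eq_aff hx] at this
  have h3 := (le_max_left _ _).trans_lt ht
  grind

theorem joinInf_le_lin_of_below {P : Finset (P1an K)} (hP : P.Nonempty)
    (hden : ∀ p ∈ P, den p ≠ 0) {x : P1an K} (hx : ∃ p ∈ P, Below p x) (a : K) :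
    joinInf P hP x ≤ lin a x := by
  obtain ⟨p, hp, h⟩ := hx
  exact (joinInf_le hP x hp).trans (join_le_lin_of_below (hden p hp) h a)

theorem exists_below_lift {P : Finset (P1an K)} (hP : P.Nonempty) (hden : ∀ p ∈ P, den p ≠ 0)
    (h0 : ∃ o ∈ P, aff 0 o = 0) (x : P1an K) : ∃ p ∈ P, Below p (lift (joinInf P hP x) x) := by
  obtain ⟨p, hp, h⟩ := exists_joinInf_eq hP x
  exact ⟨p, hp, below_lift (hden p hp) (joinInf_le_one hP h0 x) h.ge⟩

/-- The deformation retraction onto the upward closure of a finite set of points. -/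
def treeRetraction (P : Finset (P1an K)) (hP : P.Nonempty) (hden : ∀ p ∈ P, den p ≠ 0)
    (h0 : ∃ o ∈ P, aff 0 o = 0) : DefRetraction (P1an K) where
  toFun t x := lift (min t (joinInf P hP x)) x
  continuous := by
    have hs : ∀ z : unitInterval × P1an K, min (z.1 : ℝ) (joinInf P hP z.2) ≤ 1 := fun z =>
      (min_le_left _ _).trans z.1.2.2
    have hc : Continuous (joinInf P hP) :=
      Continuous.finset_inf'_apply hP fun p hp => continuous_join (hden p hp)
    refine continuous_of_coords ?_ fun a => ?_
    · simp only [den_lift (hs _)]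
      exact continuous_den.comp continuous_snd
    · simp only [lin_lift (hs _)]
      exact ((continuous_lin a).comp continuous_snd).max
        ((continuous_subtype_val.comp continuous_fst).min (hc.comp continuous_snd))
  start x := lift_eq_self ((min_le_left _ _).trans zero_le_one) fun a =>
    (min_le_left _ _).trans (lin_nonneg a x)
  fixes_image t x := by
    refine lift_eq_self ((min_le_left _ _).trans t.2.2) fun a => (min_le_right _ _).trans ?_
    refine joinInf_le_lin_of_below hP hden ?_ a
    change ∃ p ∈ P, Below p (lift (min 1 _) x)
    rw [min_eq_right (joinInf_le_one hP h0 x)]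
    exact exists_below_lift hP hden h0 x
  final t x := by
    have ht : min (t : ℝ) (joinInf P hP x) ≤ 1 := (min_le_left _ _).trans t.2.2
    change lift (min 1 _) _ = lift (min 1 _) _
    rw [joinInf_lift hP ht, max_eq_right (min_le_right _ _),
      min_eq_right (joinInf_le_one hP h0 x)]
    have h1 := joinInf_le_one hP h0 x
    refine ext_coords ?_ fun a => ?_
    · rw [den_lift h1, den_lift ht, den_lift h1]
    · rw [lin_lift h1, lin_lift ht, lin_lift h1, max_assoc, max_eq_right (min_le_right _ _)]

variable {P : Finset (P1an K)} {hP : P.Nonempty} {hden : ∀ p ∈ P, den p ≠ 0}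
  {h0 : ∃ o ∈ P, aff 0 o = 0}

theorem treeRetraction_retract (x : P1an K) :
    (treeRetraction P hP hden h0).retract x = lift (joinInf P hP x) x := by
  change lift (min 1 _) x = _
  rw [min_eq_right (joinInf_le_one hP h0 x)]

theorem mem_skeleton_treeRetraction {x : P1an K} :
    x ∈ (treeRetraction P hP hden h0).skeleton ↔ ∃ p ∈ P, Below p x := by
  constructor
  · rintro ⟨y, rfl⟩
    rw [treeRetraction_retract]
    exact exists_below_lift hP hden h0 y
  · intro h
    refine ⟨x, ?_⟩
    rw [treeRetraction_retract]
    exact lift_eq_self (joinInf_le_one hP h0 x) fun a => joinInf_le_lin_of_below hP hden h a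

theorem isFiniteGraph_treeRetraction [IsUltrametricDist K] :
    IsFiniteGraph (treeRetraction P hP hden h0).skeleton := by
  classical
  obtain ⟨q, hq⟩ := exists_den_eq_zero K
  refine ⟨P.image fun p => (p, q), ?_, ?_⟩
  · intro s hs
    obtain ⟨p, -, rfl⟩ := Finset.mem_image.1 hs
    exact below_of_den_eq_zero hq
  · ext x
    rw [mem_skeleton_treeRetraction]
    simp [segment, below_of_den_eq_zero hq]

theorem den_treeRetraction (x : P1an K) :
    den ((treeRetraction P hP hden h0).retract x) = den x := by
  rw [treeRetraction_retract, den_lift (joinInf_le_one hP h0 x)]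

theorem scale_treeRetraction (x : P1an K) :
    scale ((treeRetraction P hP hden h0).retract x) = scale x := by
  unfold scale
  rw [den_treeRetraction]

/-! ### Paths of a deformation retraction -/

/-- The path of `x` enters or leaves the disc, hence passes through its Gauss point `y`; all points
of a path have the same final image. -/
theorem DefRetraction.retract_eq_of_isGaussPoint (ψ : DefRetraction (P1an K)) {a : K} {r : ℝ}
    {x y : P1an K} (hy : IsGaussPoint a r y)
    (h : x ∈ disc a r ↔ ψ.retract x ∉ disc a r) : ψ.retract x = ψ.retract y := by
  have hS : IsPreconnected (Set.range fun t => ψ.toFun t x) :=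
    isPreconnected_range (ψ.continuous.comp (Continuous.prodMk_left x))
  have hx : x ∈ Set.range fun t => ψ.toFun t x := ⟨0, ψ.start x⟩
  have hrx : ψ.retract x ∈ Set.range fun t => ψ.toFun t x := ⟨1, rfl⟩
  have hmem : y ∈ Set.range fun t => ψ.toFun t x := by
    by_cases hxd : x ∈ disc a r
    · exact hy.mem hS hx hrx hxd (h.1 hxd)
    · exact hy.mem hS hrx hx (not_not.1 fun h' => hxd (h.2 h')) hxd
  obtain ⟨t, rfl⟩ := hmem
  exact (ψ.final t x).symm

/-- If the new retraction moves `x`, it moves it to the Gauss point of a disc containing `x`. The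
endpoint of the `ψ`-path of `x` lies above some `p` in `P`; were it in this disc, `p` would be too,
and `x` would meet the tree at a smaller radius. So the `ψ`-path leaves the disc through that Gauss
point. -/
theorem retract_treeRetraction (ψ : DefRetraction (P1an K))
    (hψ : ∀ x ∈ ψ.skeleton, ∃ p ∈ P, Below p x) (x : P1an K) :
    ψ.retract ((treeRetraction P hP hden h0).retract x) = ψ.retract x := by
  rw [treeRetraction_retract]
  set s := joinInf P hP x with hs
  have hs1 : s ≤ 1 := joinInf_le_one hP h0 x
  by_cases hx : den x = 0
  · rw [lift, up_of_den_eq_zero hx]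
  by_cases h : ∀ a, s ≤ lin a x
  · rw [lift_eq_self hs1 h]
  push Not at h
  obtain ⟨a, ha⟩ := h
  have hx' := den_pos_iff.2 hx
  have hlt : aff a x < s / den x := div_lt_div_of_pos_right ha hx'
  refine (ψ.retract_eq_of_isGaussPoint (isGaussPoint_up hx hlt.le)
    (iff_of_true (mem_disc.2 ⟨hx, hlt⟩) fun hd => ?_)).symm
  obtain ⟨p, hp, hpx⟩ := hψ _ ⟨x, rfl⟩
  obtain ⟨hd0, hd⟩ := mem_disc.1 hd
  have h1 := (below_iff_aff (hden p hp) hd0).1 hpx a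
  have h2 : aff a p * den x < s := by
    rw [← lt_div_iff₀ hx']
    exact h1.trans_lt hd
  have h3 := (joinInf_le hP x hp).trans (join_le p x a)
  exact absurd (h3.trans_lt (max_lt ha h2)) (lt_irrefl _)

theorem isPreconnected_skeleton [IsUltrametricDist K] (ψ : DefRetraction (P1an K)) :
    IsPreconnected ψ.skeleton :=
  isPreconnected_range (ψ.continuous.comp (Continuous.prodMk_right 1))

end Retraction

/-! ### Piecewise monomial functions -/

section PiecewiseMonomial

theorem le_iff_le_of_notMem {J : Set ℝ} (hJ : J.OrdConnected) {t x y : ℝ} (ht : t ∉ J) (hx : x ∈ J)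
    (hy : y ∈ J) : t ≤ x ↔ t ≤ y := by
  have key : ∀ {x y : ℝ}, x ∈ J → y ∈ J → t ≤ x → t ≤ y := fun hx hy h =>
    le_of_not_gt fun h' => ht (hJ.out hy hx ⟨h'.le, h⟩)
  exact ⟨key hx hy, key hy hx⟩

theorem forall_lt_or_forall_gt {J : Set ℝ} (hJ : J.OrdConnected) {t : ℝ} (ht : t ∉ J) :
    (∀ x ∈ J, x < t) ∨ ∀ x ∈ J, t < x := by
  by_contra! h
  obtain ⟨⟨x, hx, htx⟩, y, hy, hyt⟩ := h
  exact ht (hJ.out hy hx ⟨hyt, htx⟩)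

/-- On the set `Z`, after removal of finitely many values of `ρ`, the function `M` is a monomial in
`ρ` over each interval of values in `(0, ∞)`. -/
def IsPiecewiseMonomial {X : Type*} (Z : Set X) (ρ M : X → ℝ) : Prop :=
  ∃ B : Finset ℝ, ∀ J : Set ℝ, J.OrdConnected → J ⊆ Set.Ioi 0 → Disjoint J (B : Set ℝ) →
    ∃ c α : ℝ, 0 ≤ c ∧ ∀ z ∈ Z, ρ z ∈ J → M z = c * ρ z ^ α

variable {X : Type*} {Z : Set X} {ρ M M' : X → ℝ}

theorem IsPiecewiseMonomial.mul (h : IsPiecewiseMonomial Z ρ M) (h' : IsPiecewiseMonomial Z ρ M') :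
    IsPiecewiseMonomial Z ρ fun z => M z * M' z := by
  classical
  obtain ⟨B, hB⟩ := h
  obtain ⟨B', hB'⟩ := h'
  refine ⟨B ∪ B', fun J hJ hJ0 hJB => ?_⟩
  rw [Finset.coe_union, Set.disjoint_union_right] at hJB
  obtain ⟨c, α, hc, hcα⟩ := hB J hJ hJ0 hJB.1
  obtain ⟨c', α', hc', hcα'⟩ := hB' J hJ hJ0 hJB.2
  refine ⟨c * c', α + α', mul_nonneg hc hc', fun z hz hzJ => ?_⟩
  simp only [hcα z hz hzJ, hcα' z hz hzJ, Real.rpow_add (hJ0 hzJ)]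
  ring

theorem IsPiecewiseMonomial.min_one (h : IsPiecewiseMonomial Z ρ M) :
    IsPiecewiseMonomial Z ρ fun z => min 1 (M z) := by
  classical
  obtain ⟨B, hB⟩ := h
  -- The intervals cut out by `B` in `(0, ∞)`, indexed by the set of break points to their left.
  -- There are finitely many relevant ones, so the coefficients can be chosen before `J` is given.
  let I : Finset ℝ → Set ℝ := fun S => {x | 0 < x ∧ ∀ b ∈ B, b ≠ x ∧ (b ≤ x ↔ b ∈ S)}
  have hI : ∀ S, (I S).OrdConnected := by
    refine fun S => ⟨fun x hx y hy t ht => ⟨hx.1.trans_le ht.1, fun b hb => ?_⟩⟩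
    obtain ⟨h1, h2⟩ := hx.2 b hb
    obtain ⟨h3, h4⟩ := hy.2 b hb
    have h5 := ht.1
    have h6 := ht.2
    by_cases hbS : b ∈ S
    · have := lt_of_le_of_ne (h2.2 hbS) h1
      exact ⟨by linarith, iff_of_true (by linarith) hbS⟩
    · have : y < b := not_le.1 fun h => hbS (h4.1 h)
      exact ⟨by intro h; linarith, iff_of_false (by intro h; linarith) hbS⟩
  choose c α hc hcα using fun S => hB (I S) (hI S) (fun x hx => hx.1)
    (Set.disjoint_left.2 fun x hx hxB => (hx.2 x hxB).1 rfl)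
  -- The extra break points are the solutions of `c t^α = 1`, beyond which a monomial cannot cross
  -- `1`. For `c = 0` or `α = 0` the value included is meaningless but harmless.
  refine ⟨B ∪ B.powerset.image fun S => c S ^ (-(α S)⁻¹), fun J hJ hJ0 hJB => ?_⟩
  rw [Finset.coe_union, Set.disjoint_union_right] at hJB
  rcases J.eq_empty_or_nonempty with rfl | ⟨x₀, hx₀⟩
  · exact ⟨0, 0, le_rfl, fun z _ hz => hz.elim⟩
  set S := B.filter (· ≤ x₀) with hS
  have hJS : J ⊆ I S := fun x hx => ⟨hJ0 hx, fun b hb => by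
    have hbJ : b ∉ J := fun h => Set.disjoint_left.1 hJB.1 h hb
    refine ⟨fun h => hbJ (h ▸ hx), ?_⟩
    rw [hS, Finset.mem_filter, le_iff_le_of_notMem hJ hbJ hx hx₀]
    exact (and_iff_right hb).symm⟩
  have hM : ∀ z ∈ Z, ρ z ∈ J → M z = c S * ρ z ^ α S := fun z hz hzJ => hcα S z hz (hJS hzJ)
  have htJ : c S ^ (-(α S)⁻¹) ∉ J := fun h => Set.disjoint_left.1 hJB.2 h <| by
    rw [Finset.mem_coe, Finset.mem_image]
    exact ⟨S, Finset.mem_powerset.2 (Finset.filter_subset _ _), rfl⟩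
  rcases (hc S).eq_or_lt with hc0 | hc0
  · refine ⟨0, 0, le_rfl, fun z hz hzJ => ?_⟩
    simp only [hM z hz hzJ, ← hc0, zero_mul]
    exact min_eq_right zero_le_one
  by_cases hα : α S = 0
  · refine ⟨min 1 (c S), 0, le_min zero_le_one (hc S), fun z hz hzJ => ?_⟩
    simp only [hM z hz hzJ, hα, Real.rpow_zero, mul_one]
  set t := c S ^ (-(α S)⁻¹) with ht
  have ht0 : 0 < t := Real.rpow_pos_of_pos hc0 _
  have hct : c S * t ^ α S = 1 := by
    rw [ht, ← Real.rpow_mul hc0.le, neg_mul, inv_mul_cancel₀ hα, Real.rpow_neg_one,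
      mul_inv_cancel₀ hc0.ne']
  have hone : (∀ z ∈ Z, ρ z ∈ J → 1 ≤ M z) ∨ ∀ z ∈ Z, ρ z ∈ J → M z ≤ 1 := by
    rcases forall_lt_or_forall_gt hJ htJ with hlt | hlt <;> rcases lt_or_gt_of_ne hα with hs | hs
    · refine Or.inl fun z hz hzJ => ?_
      rw [hM z hz hzJ, ← hct]
      exact mul_le_mul_of_nonneg_left
        (Real.rpow_le_rpow_of_nonpos (hJ0 hzJ) (hlt _ hzJ).le hs.le) hc0.le
    · refine Or.inr fun z hz hzJ => ?_
      rw [hM z hz hzJ, ← hct]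
      exact mul_le_mul_of_nonneg_left
        (Real.rpow_le_rpow (hJ0 hzJ).le (hlt _ hzJ).le hs.le) hc0.le
    · refine Or.inr fun z hz hzJ => ?_
      rw [hM z hz hzJ, ← hct]
      exact mul_le_mul_of_nonneg_left
        (Real.rpow_le_rpow_of_nonpos ht0 (hlt _ hzJ).le hs.le) hc0.le
    · refine Or.inl fun z hz hzJ => ?_
      rw [hM z hz hzJ, ← hct]
      exact mul_le_mul_of_nonneg_left
        (Real.rpow_le_rpow ht0.le (hlt _ hzJ).le hs.le) hc0.le
  rcases hone with h | h
  · refine ⟨1, 0, zero_le_one, fun z hz hzJ => ?_⟩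
    rw [Real.rpow_zero, mul_one]
    exact min_eq_left (h z hz hzJ)
  · refine ⟨c S, α S, hc S, fun z hz hzJ => ?_⟩
    rw [← hM z hz hzJ]
    exact min_eq_right (h z hz hzJ)

end PiecewiseMonomial

/-! ### Chains of points -/

section Chains

variable {K : Type u} [NormedField K]

theorem DefRetraction.retract_of_mem (ψ : DefRetraction (P1an K)) {z : P1an K}
    (hz : z ∈ ψ.skeleton) : ψ.retract z = z := by
  obtain ⟨y, rfl⟩ := hz
  exact ψ.fixes_image 1 y

theorem den_ne_zero_of_radius_pos {z : P1an K} (h : 0 < radius z) : den z ≠ 0 := by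
  intro hz
  rw [radius_eq] at h
  simp [aff, hz] at h

variable [IsAlgClosed K]

/-- Along the path upwards from `p`, lying above `p'` is a threshold condition on the radius. It
yields the break points where the path meets the part of the tree above a lower endpoint. -/
theorem below_iff_join_le {p p' z : P1an K} (hp' : den p' ≠ 0) (h : Below p z) (hz : den z ≠ 0) :
    Below p' z ↔ join p' p / den p ≤ radius z := by
  have hp := h.den_ne_zero hz
  have hpos := den_pos_iff.2 hp
  rw [below_iff_aff hp' hz]
  have hle := (below_iff_aff hp hz).1 h
  constructor
  · intro h'
    refine le_of_forall_gt_imp_ge_of_dense fun t ht => ?_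
    obtain ⟨b, hb⟩ := exists_aff_lt ht
    rw [div_le_iff₀ hpos]
    refine (join_le p' p b).trans (max_le ?_ ?_)
    · rw [lin_eq_aff hp]
      exact mul_le_mul_of_nonneg_right ((hle b).trans hb.le) hpos.le
    · exact mul_le_mul_of_nonneg_right ((h' b).trans hb.le) hpos.le
  · intro h' a
    rw [aff_eq_max_radius h hz]
    refine le_of_forall_gt_imp_ge_of_dense fun t ht => ?_
    have ht' : join p' p < t * den p := by
      rw [← div_lt_iff₀ hpos]
      exact h'.trans_lt ((le_max_right _ _).trans_lt ht)
    obtain ⟨b, hb⟩ := exists_lt_of_ciInf_lt ht'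
    rw [lin_eq_aff hp, ← max_mul_of_nonneg _ _ hpos.le] at hb
    have hb' := lt_of_mul_lt_mul_right hb hpos.le
    have h1 := aff_le hp' b a
    have h2 := norm_sub_le_aff hp b a
    have h3 := (le_max_left _ _).trans_lt ht
    grind

theorem below_iff_radius_le {p z q : P1an K} (hpz : Below p z) (hz : den z ≠ 0) (hq : den q ≠ 0) :
    Below z q ↔ Below p q ∧ radius z ≤ radius q := by
  constructor
  · intro h
    exact ⟨hpz.trans h, le_ciInf fun a => (radius_le z a).trans ((below_iff_aff hz hq).1 h a)⟩
  · rintro ⟨h, hr⟩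
    rw [below_iff_aff hz hq]
    intro a
    rw [aff_eq_max_radius hpz hz, aff_eq_max_radius h hq]
    exact max_le_max_left _ hr

theorem isPiecewiseMonomial_scale (p q : P1an K) :
    IsPiecewiseMonomial (segment p q) radius scale := by
  set m := max 1 (aff 0 p) with hm
  -- On points above `p`, the value `|T|` is the larger of its value at `p` and the radius, so the
  -- only break is at `max 1 (aff 0 p)`.
  have hs : ∀ z ∈ segment p q, 0 < radius z → scale z = max m (radius z) ^ 2 := by
    intro z hz hr
    have hz0 := den_ne_zero_of_radius_pos hr
    rw [scale, if_neg hz0, one_div_den hz0, aff_eq_max_radius hz.1 hz0, ← max_assoc]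
  refine ⟨{m}, fun J hJ hJ0 hJB => ?_⟩
  rw [Finset.coe_singleton, Set.disjoint_singleton_right] at hJB
  rcases forall_lt_or_forall_gt hJ hJB with h | h
  · refine ⟨m ^ 2, 0, by positivity, fun z hz hzJ => ?_⟩
    rw [hs z hz (hJ0 hzJ), max_eq_left (h _ hzJ).le, Real.rpow_zero, mul_one]
  · refine ⟨1, 2, zero_le_one, fun z hz hzJ => ?_⟩
    rw [hs z hz (hJ0 hzJ), max_eq_right (h _ hzJ).le, one_mul, Real.rpow_two]

/-- Suppose first that a lower endpoint lies below `z'`, hence below `z`. As the skeleton is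
connected and misses `z`, it lies in one disc with Gauss point `z`, while `z'` is outside; the path
of `z'` crosses `z`. If there is no such endpoint, the disc below `z'` that contains `z` is disjoint
from the skeleton, and the path of `z` leaves it through `z'`. -/
theorem DefRetraction.retract_eq_of_chain [IsUltrametricDist K] (ψ : DefRetraction (P1an K))
    {S : Finset (P1an K × P1an K)} (hS : ∀ s ∈ S, Below s.1 s.2)
    (hψ : ψ.skeleton = ⋃ s ∈ S, segment s.1 s.2) {z z' : P1an K} (h : Below z z')
    (hz' : den z' ≠ 0) (hzψ : z ∉ ψ.skeleton) (hSz : ∀ s ∈ S, Below s.1 z' → Below s.1 z) :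
    ψ.retract z = ψ.retract z' := by
  by_cases hne : z = z'
  · rw [hne]
  have hz := h.den_ne_zero hz'
  by_cases hex : ∃ s ∈ S, Below s.1 z'
  · obtain ⟨s, hs, hsz'⟩ := hex
    have hsψ : s.1 ∈ ψ.skeleton := by
      rw [hψ]
      exact Set.mem_biUnion hs ⟨Below.refl _, hS s hs⟩
    obtain ⟨a, r, hr, hg, hd⟩ := exists_isGaussPoint_of_below (hSz s hs hsz') hz
      (fun e => hzψ (e ▸ hsψ))
    have hsub : ∀ w ∈ ψ.skeleton, w ∈ disc a r := fun w hw => by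
      by_contra hwd
      exact hzψ (hg.mem (isPreconnected_skeleton ψ) hsψ hw hd hwd)
    have hz'd : z' ∉ disc a r := by
      intro hd'
      have h1 := mem_disc.1 hd'
      exact hne (h.antisymm ((hg.below_iff hr.le).2 ⟨h1.1, h1.2.le⟩))
    exact (ψ.retract_eq_of_isGaussPoint hg
      (iff_of_false hz'd (not_not.2 (hsub _ ⟨z', rfl⟩)))).symm
  · obtain ⟨a, r, hr, hg, hd⟩ := exists_isGaussPoint_of_below h hz' hne
    refine ψ.retract_eq_of_isGaussPoint hg (iff_of_true hd fun hd' => hex ?_)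
    have hw : ψ.retract z ∈ ψ.skeleton := ⟨z, rfl⟩
    rw [hψ] at hw
    obtain ⟨s, hs, hws⟩ := Set.mem_iUnion₂.1 hw
    have h1 := mem_disc.1 hd'
    exact ⟨s, hs, hws.1.trans ((hg.below_iff hr.le).2 ⟨h1.1, h1.2.le⟩)⟩

theorem isPiecewiseMonomial_comp_retract [IsUltrametricDist K] {ψ : DefRetraction (P1an K)}
    (hψ : IsFiniteGraph ψ.skeleton) {M : P1an K → ℝ} (hM0 : ∀ z ∈ ψ.skeleton, 0 ≤ M z)
    (hM : IsLogPiecewiseLinear ψ.skeleton M) (p q : P1an K) :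
    IsPiecewiseMonomial (segment p q) radius fun z => M (ψ.retract z) := by
  classical
  obtain ⟨S, hS, hψS⟩ := hψ
  have hsub : ∀ s ∈ S, segment s.1 s.2 ⊆ ψ.skeleton := fun s hs => by
    rw [hψS]
    exact Set.subset_biUnion_of_mem (u := fun s : P1an K × P1an K => segment s.1 s.2) hs
  choose! B hB using fun s hs => hM s.1 s.2 (hS s hs) (hsub s hs)
  -- Besides the break points of `M` on the arcs of the skeleton, these are the radii at which the
  -- path upwards from `p` comes to lie above a lower endpoint, and the radii of the upper
  -- endpoints. Away from them, membership in each arc does not change.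
  refine ⟨S.biUnion B ∪ (S.image (fun s => join s.1 p / den p) ∪ S.image fun s => radius s.2),
    fun J hJ hJ0 hJB => ?_⟩
  rw [Set.disjoint_right] at hJB
  have hJ1 : ∀ s ∈ S, join s.1 p / den p ∉ J := fun s hs => hJB (by
    simp only [Finset.coe_union, Set.mem_union, Finset.mem_coe, Finset.mem_image]
    exact Or.inr (Or.inl ⟨s, hs, rfl⟩))
  have hJ2 : ∀ s ∈ S, radius s.2 ∉ J := fun s hs => hJB (by
    simp only [Finset.coe_union, Set.mem_union, Finset.mem_coe, Finset.mem_image]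
    exact Or.inr (Or.inr ⟨s, hs, rfl⟩))
  have hJ3 : ∀ s ∈ S, Disjoint J (B s : Set ℝ) := fun s hs => Set.disjoint_right.2 fun b hb =>
    hJB (by
      simp only [Finset.coe_union, Set.mem_union, Finset.mem_coe, Finset.mem_biUnion]
      exact Or.inl ⟨s, hs, hb⟩)
  have hlow : ∀ s ∈ S, ∀ z z', Below p z → Below p z' → radius z ∈ J → radius z' ∈ J →
      Below s.1 z → Below s.1 z' := by
    intro s hs z z' hz hz' hzJ hzJ' h
    have hz0 := den_ne_zero_of_radius_pos (hJ0 hzJ)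
    have hs0 := h.den_ne_zero hz0
    rw [below_iff_join_le hs0 hz hz0, le_iff_le_of_notMem hJ (hJ1 s hs) hzJ hzJ'] at h
    exact (below_iff_join_le hs0 hz' (den_ne_zero_of_radius_pos (hJ0 hzJ'))).2 h
  have hhigh : ∀ s ∈ S, ∀ z z', Below p z → Below p z' → radius z ∈ J → radius z' ∈ J →
      Below z s.2 → Below z' s.2 := by
    intro s hs z z' hz hz' hzJ hzJ' h
    by_cases hs0 : den s.2 = 0
    · exact below_of_den_eq_zero hs0
    have hz0 := den_ne_zero_of_radius_pos (hJ0 hzJ)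
    rw [below_iff_radius_le hz hz0 hs0] at h
    rw [below_iff_radius_le hz' (den_ne_zero_of_radius_pos (hJ0 hzJ')) hs0]
    refine ⟨h.1, le_of_not_gt fun hlt => hJ2 s hs (hJ.out hzJ hzJ' ⟨h.2, hlt.le⟩)⟩
  -- If the part of the segment over `J` meets the skeleton, it lies in one of its arcs, where `ψ`
  -- is the identity. Otherwise `ψ` is constant on it.
  by_cases hex : ∃ z ∈ segment p q, radius z ∈ J ∧ z ∈ ψ.skeleton
  · obtain ⟨z₀, hz₀, hz₀J, hz₀ψ⟩ := hex
    rw [hψS] at hz₀ψ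
    obtain ⟨s, hs, hz₀s⟩ := Set.mem_iUnion₂.1 hz₀ψ
    obtain ⟨c, α, hc, h⟩ := hB s hs J hJ hJ0 (hJ3 s hs)
    refine ⟨c, α, hc, fun z hz hzJ => ?_⟩
    have hzs : z ∈ segment s.1 s.2 := ⟨hlow s hs z₀ z hz₀.1 hz.1 hz₀J hzJ hz₀s.1,
      hhigh s hs z₀ z hz₀.1 hz.1 hz₀J hzJ hz₀s.2⟩
    simp only [ψ.retract_of_mem (hsub s hs hzs), h z hzs hzJ]
  · push Not at hex
    have hle : ∀ z ∈ segment p q, ∀ z' ∈ segment p q, radius z ∈ J → radius z' ∈ J →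
        radius z ≤ radius z' → ψ.retract z = ψ.retract z' := by
      intro z hz z' hz' hzJ hzJ' h
      have hz0 := den_ne_zero_of_radius_pos (hJ0 hzJ)
      have hz0' := den_ne_zero_of_radius_pos (hJ0 hzJ')
      exact ψ.retract_eq_of_chain hS hψS ((below_iff_radius_le hz.1 hz0 hz0').2 ⟨hz'.1, h⟩) hz0'
        (hex z hz hzJ) fun s hs => hlow s hs z' z hz'.1 hz.1 hzJ' hzJ
    by_cases hne : ∃ z ∈ segment p q, radius z ∈ J
    · obtain ⟨z₀, hz₀, hz₀J⟩ := hne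
      refine ⟨M (ψ.retract z₀), 0, hM0 _ ⟨z₀, rfl⟩, fun z hz hzJ => ?_⟩
      rw [Real.rpow_zero, mul_one]
      rcases le_total (radius z) (radius z₀) with h | h
      · exact congrArg M (hle z hz z₀ hz₀ hzJ hz₀J h)
      · exact congrArg M (hle z₀ hz₀ z hz hz₀J hzJ h).symm
    · exact ⟨0, 0, le_rfl, fun z hz hzJ => (hne ⟨z, hz, hzJ⟩).elim⟩

end Chains

/-! ### From polyradii to radii -/

section Main

variable {k : Type u} [NormedField k] [IsUltrametricDist k] [IsAlgClosed k]

theorem exists_controlsRadii {φ : FiniteEndo k} {ψ : DefRetraction (P1an k)} {M : P1an k → ℝ}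
    (h : ControlsPolyradii φ minRadius ψ M) : ∃ (ψ' : DefRetraction (P1an k)) (M' : P1an k → ℝ),
      ControlsRadii φ ψ' M' ∧ (SharpPolyradii φ ψ M → SharpRadii φ ψ' M') := by
  classical
  obtain ⟨S, hS, hψS⟩ := h.finiteGraph
  obtain ⟨o, ho, hoa⟩ := exists_aff_eq_norm (0 : k)
  -- The origin keeps all paths within normalized radius `1`. Lower endpoints at infinity may be
  -- dropped: such an arc is the point infinity, which lies above the origin.
  set P : Finset (P1an k) := insert o ((S.image Prod.fst).filter fun p => den p ≠ 0) with hPdef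
  have hoP : o ∈ P := Finset.mem_insert_self _ _
  have hP : P.Nonempty := ⟨o, hoP⟩
  have hden : ∀ p ∈ P, den p ≠ 0 := by
    intro p hp
    rcases Finset.mem_insert.1 hp with rfl | hp
    · exact ho
    · exact (Finset.mem_filter.1 hp).2
  have h0 : ∃ o ∈ P, aff 0 o = 0 := ⟨o, hoP, by rw [hoa, sub_self, norm_zero]⟩
  have hψP : ∀ x ∈ ψ.skeleton, ∃ p ∈ P, Below p x := by
    intro x hx
    rw [hψS] at hx
    obtain ⟨s, hs, hxs⟩ := Set.mem_iUnion₂.1 hx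
    by_cases hs0 : den s.1 = 0
    · exact ⟨o, hoP, below_of_den_eq_zero (hxs.1.den_eq_zero hs0)⟩
    · exact ⟨s.1, Finset.mem_insert_of_mem
        (Finset.mem_filter.2 ⟨Finset.mem_image_of_mem _ hs, hs0⟩), hxs.1⟩
  set ψ' := treeRetraction P hP hden h0 with hψ'
  have hret : ∀ x, ψ.retract (ψ'.retract x) = ψ.retract x := retract_treeRetraction ψ hψP
  have hnonneg : ∀ x, 0 ≤ M (ψ.retract x) := fun x => h.nonneg _ ⟨x, rfl⟩
  -- Composition with `ψ` recovers the size measured in the charts, `scale` converts it to a radius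
  -- in `T`, and `1` is the imposed bound. Since `ψ'` changes neither `ψ` nor `scale`, the value
  -- depends on `x` in the required way.
  set M' : P1an k → ℝ := fun γ => min 1 (M (ψ.retract γ) * scale γ) with hM'
  have hM'v : ∀ {γ x : P1an k}, ψ'.retract x = γ →
      ∀ (L : Type u) [NormedField L] [IsUltrametricDist L] [NormedAlgebra k L] (v : Fin 2 → L)
        (hv : v ≠ 0), pointBelow k L v hv = x →
        M' γ = min 1 (M (ψ.retract x) * radiusRatio v) := by
    rintro γ x rfl L _ _ _ v hv rfl
    simp only [hM', hret]
    rw [scale_treeRetraction, scale_pointBelow]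
  have hne : ∀ {γ x : P1an k}, ψ'.retract x = γ → M' γ ≠ 0 → M (ψ.retract x) ≠ 0 := by
    rintro γ x rfl hγ h
    refine hγ ?_
    simp only [hM', hret, h, zero_mul]
    exact min_eq_right zero_le_one
  have hzero : ∀ {γ x : P1an k}, ψ'.retract x = γ → M' γ = 0 → M (ψ.retract x) = 0 := by
    rintro γ x rfl hγ
    by_contra hcon
    have h1 := (hnonneg x).lt_of_ne' hcon
    refine (lt_min one_pos (mul_pos h1 (scale_pos (ψ'.retract x)))).ne' ?_
    rw [← hret x]
    exact hγ
  refine ⟨ψ', M', ⟨isFiniteGraph_treeRetraction, fun γ _ => ⟨?_, min_le_left _ _⟩, ?_, ?_, ?_, ?_⟩,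
    ?_⟩
  · exact le_min zero_le_one (mul_nonneg (hnonneg γ) (scale_pos γ).le)
  · obtain ⟨γ, hγ, hMγ⟩ := h.not_identically_zero
    refine ⟨γ, mem_skeleton_treeRetraction.2 (hψP γ hγ), ?_⟩
    have h1 := (h.nonneg γ hγ).lt_of_ne' hMγ
    simp only [hM', ψ.retract_of_mem hγ]
    exact (lt_min one_pos (mul_pos h1 (scale_pos γ))).ne'
  · intro p q _ _
    exact ((isPiecewiseMonomial_comp_retract h.finiteGraph h.nonneg h.logPiecewiseLinear p q).mul
      (isPiecewiseMonomial_scale p q)).min_one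
  · intro γ _ hMγ x hx L _ _ _ _ _ v hv hvx
    obtain ⟨W, ρ, hW, hρ, hsplit⟩ := h.attained _ ⟨x, rfl⟩ (hne hx hMγ.ne') x rfl L v hv hvx
    have hval := hM'v hx L v hv hvx
    rw [hval] at hMγ ⊢
    rw [← hρ] at hMγ ⊢
    refine φ.splitsIntoBalls_ballAround hMγ ?_
    -- The member `W` of maximal size need not itself be the ball, but it contains the ball
    -- determined by its smallest radius.
    exact Decomposes.mono (φ.continuous_an L) hsplit (isOpen_ballAround v hMγ)
      (ballAround_subset hv hW)
  · intro γ _ hMγ x hx L _ _ _ _ _ v hv hvx r hr hr1 hsplit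
    obtain ⟨ρ, hρ, hρr⟩ := exists_hasPolyradius hv hr hr1
    have hle := h.maximal _ ⟨x, rfl⟩ (hne hx hMγ.ne') x rfl L v hv hvx _ ρ hρ
      (Decomposes.weaken hsplit)
    rw [hM'v hx L v hv hvx]
    refine le_min hr1 ?_
    rw [← hρr]
    exact mul_le_mul_of_nonneg_right hle (radiusRatio_pos v).le
  · intro hsharp γ _ hMγ x hx L _ _ _ _ _ v hv hvx r hr hr1 hsplit
    obtain ⟨ρ, hρ, -⟩ := exists_hasPolyradius hv hr hr1
    exact hsharp _ ⟨x, rfl⟩ (hzero hx hMγ) x rfl L v hv hvx _ ρ hρ (Decomposes.weaken hsplit)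

end Main

end

end BerkovichLine

theorem proposition6p2 {k : Type u} [NontriviallyNormedField k] [IsUltrametricDist k]
    [CompleteSpace k] [IsAlgClosed k] (φ : BerkovichLine.FiniteEndo k) :
    ((∀ g, BerkovichLine.IsSizeFunction g →
        ∃ ψ M, BerkovichLine.ControlsPolyradii φ g ψ M) →
      ∃ ψ M, BerkovichLine.ControlsRadii φ ψ M) ∧
    ((∀ g, BerkovichLine.IsSizeFunction g →
        ∃ ψ M, BerkovichLine.ControlsPolyradii φ g ψ M ∧ BerkovichLine.SharpPolyradii φ ψ M) →
      ∃ ψ M, BerkovichLine.ControlsRadii φ ψ M ∧ BerkovichLine.SharpRadii φ ψ M) := by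
  constructor
  · intro h
    obtain ⟨ψ, M, hM⟩ := h _ BerkovichLine.isSizeFunction_minRadius
    obtain ⟨ψ', M', hM', -⟩ := BerkovichLine.exists_controlsRadii hM
    exact ⟨ψ', M', hM'⟩
  · intro h
    obtain ⟨ψ, M, hM, hsharp⟩ := h _ BerkovichLine.isSizeFunction_minRadius
    obtain ⟨ψ', M', hM', hsharp'⟩ := BerkovichLine.exists_controlsRadii hM
    exact ⟨ψ', M', hM', hsharp' hsharp⟩
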